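/- Let $\Bbbk$ be a field of characteristic zero. Morphisms in strict $\Bbbk$-linear monoidal categories are drawn as string diagrams read from bottom to top, with $f\otimes g$ drawn as $f$ to the left of $g$, and $f\circ g$ as $f$ above $g$. Let $\mathcal{AH}$ be the strict $\Bbbk$-linear monoidal category generated by one object $\uparrow$ and morphisms $x:\uparrow\to\uparrow$ (the dot) and $s:\uparrow\otimes\uparrow\to\uparrow\otimes\uparrow$ (the crossing) subject to $$s\circ s=1,\qquad (s\otimes 1)\circ(1\otimes s)\circ(s\otimes 1)=(1\otimes s)\circ(s\otimes 1)\circ(1\otimes s),$$ $$s\circ(x\otimes 1)=(1\otimes x)\circ s+1,\qquad (x\otimes 1)\circ s=s\circ(1\otimes x)+1 .$$ Let $\mathcal{AH}\,\odot\,\mathcal{AH}$ be the symmetric product of a blue copy, with generators $b,x_b,s_b$, and a red copy, with generators $r,x_r,s_r$, of $\mathcal{AH}$. It is the strict $\Bbbk$-linear monoidal category generated by both copies together with mutually inverse morphisms $\sigma:b\otimes r\to r\otimes b$ and $\sigma^{-1}$ such that $$\sigma\circ(x_b\otimes 1)=(1\otimes x_b)\circ\sigma,\qquad \sigma\circ(1\otimes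 x_r)=(x_r\otimes 1)\circ\sigma,$$ $$\sigma_{bb,r}\circ(s_b\otimes 1_r)=(1_r\otimes s_b)\circ\sigma_{bb,r},\qquad \sigma_{b,rr}\circ(1_b\otimes s_r)=(s_r\otimes 1_b)\circ\sigma_{b,rr},$$ where $\sigma_{bb,r}=(\sigma\otimes 1_b)\circ(1_b\otimes\sigma)$ and $\sigma_{b,rr}=(1_r\otimes\sigma)\circ(\sigma\otimes 1_r)$. Let $\mathcal{AH}\,\overline\odot\,\mathcal{AH}$ be the strict $\Bbbk$-linear monoidal category obtained from it by adjoining a two-sided inverse $d_{br}$ (the dumbbell) of $1_b\otimes x_r-x_b\otimes 1_r:b\otimes r\to b\otimes r$, and put $d_{rb}:=\sigma\circ d_{br}\circ\sigma^{-1}$, which is the inverse of $x_r\otimes 1_b-1_r\otimes x_b$. Let $\eta$ be the strict $\Bbbk$-linear monoidal endofunctor of $\mathcal{AH}\,\overline\odot\,\mathcal{AH}$ that interchanges the two colours and multiplies a diagram by $(-1)^z$, where $z$ is its number of dumbbells; that is, $\eta$ interchanges $b\leftrightarrow r$, $x_b\leftrightarrow x_r$, $s_b\leftrightarrow s_r$,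 $\sigma\leftrightarrow\sigma^{-1}$ and sends $d_{br}\mapsto-d_{rb}$. For a strict $\Bbbk$-linear monoidal category $\mathcal C$, let $\operatorname{Add}(\mathcal C)$ be its additive envelope: objects are finite formal direct sums of objects of $\mathcal C$, morphisms are matrices of morphisms of $\mathcal C$, and the tensor product is extended by distributivity, summands being ordered lexicographically. The functor $\eta$ is extended to $\operatorname{Add}(\mathcal{AH}\,\overline\odot\,\mathcal{AH})$ summand by summand and entry by entry. **Theorem.** There is a strict $\Bbbk$-linear monoidal functor $$\Delta:\mathcal{AH}\to\operatorname{Add}(\mathcal{AH}\,\overline\odot\,\mathcal{AH})$$ with $\Delta(\uparrow)=b\oplus r$, $\Delta(x)=x_b+x_r$ (the diagonal matrix with these entries) and $$\Delta(s)=s_b+s_r+\sigma+\sigma^{-1}-\sigma\circ d_{br}+\sigma^{-1}\circ d_{rb}-d_{br}+d_{rb}.$$ Here the right-hand side denotes the endomorphism of $b\otimes b\,\oplus\,b\otimes r\,\oplus\,r\otimes b\,\oplus\,r\otimes r$ whose matrix entry between two given summands is the sum of those listed terms that have these summands as source and target. Moreover $\eta\circ\Delta=\Delta$ up to the order of the summands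 in formal direct sums: there is a monoidal natural isomorphism $\theta:\eta\circ\Delta\Rightarrow\Delta$ all of whose components merely permute summands (each summand of the source is sent by an identity morphism to a summand of the target, along a bijection of the index sets), and $\theta_\uparrow:\eta(b\oplus r)=r\oplus b\to b\oplus r$ is the interchange of the two summands. -/

import Mathlib

open CategoryTheory MonoidalCategory

universe u v w

set_option linter.unusedSectionVars false

noncomputable section

namespace Heis

/-! ### Strict monoidal categories and strict monoidal functors -/

/-- A monoidal category is strict if tensor products of objects are associative and unital on the
nose and the associators and unitors are identities. -/
class StrictMonoidalCategory (C : Type v) [Category.{u} C] [MonoidalCategory C] : Prop where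
  tensor_assoc : ∀ X Y Z : C, (X ⊗ Y) ⊗ Z = X ⊗ (Y ⊗ Z)
  unit_tensor : ∀ X : C, 𝟙_ C ⊗ X = X
  tensor_unit : ∀ X : C, X ⊗ 𝟙_ C = X
  associator_hom : ∀ X Y Z : C, (α_ X Y Z).hom = eqToHom (tensor_assoc X Y Z)
  leftUnitor_hom : ∀ X : C, (λ_ X).hom = eqToHom (unit_tensor X)
  rightUnitor_hom : ∀ X : C, (ρ_ X).hom = eqToHom (tensor_unit X)

/-- A functor between strict monoidal categories is strict monoidal if it preserves the unit
object and tensor products of objects and of morphisms on the nose. -/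
structure IsStrictMonoidal {C : Type v} [Category.{u} C] [MonoidalCategory C]
    {D : Type w} [Category.{u} D] [MonoidalCategory D] (F : C ⥤ D) : Prop where
  obj_unit : F.obj (𝟙_ C) = 𝟙_ D
  obj_tensor : ∀ X Y : C, F.obj (X ⊗ Y) = F.obj X ⊗ F.obj Y
  map_tensor : ∀ {X Y X' Y' : C} (f : X ⟶ Y) (g : X' ⟶ Y'),
    F.map (f ⊗ₘ g) =
      eqToHom (obj_tensor X X') ≫ (F.map f ⊗ₘ F.map g) ≫ eqToHom (obj_tensor Y Y').symm

/-- A natural transformation between strict monoidal functors is monoidal. -/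
structure IsMonoidalNatTrans {C : Type v} [Category.{u} C] [MonoidalCategory C]
    {D : Type w} [Category.{u} D] [MonoidalCategory D] {F F' : C ⥤ D}
    (hF : IsStrictMonoidal F) (hF' : IsStrictMonoidal F') (θ : F ⟶ F') : Prop where
  unit : θ.app (𝟙_ C) = eqToHom (hF.obj_unit.trans hF'.obj_unit.symm)
  tensor : ∀ X Y : C, θ.app (X ⊗ Y) =
    eqToHom (hF.obj_tensor X Y) ≫ (θ.app X ⊗ₘ θ.app Y) ≫ eqToHom (hF'.obj_tensor X Y).symm

theorem IsStrictMonoidal.comp {C : Type v} [Category.{u} C] [MonoidalCategory C]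
    {D : Type w} [Category.{u} D] [MonoidalCategory D] {E : Type w} [Category.{u} E]
    [MonoidalCategory E] {F : C ⥤ D} {F' : D ⥤ E} (hF : IsStrictMonoidal F)
    (hF' : IsStrictMonoidal F') : IsStrictMonoidal (F ⋙ F') where
  obj_unit := (congrArg F'.obj hF.obj_unit).trans hF'.obj_unit
  obj_tensor X Y := (congrArg F'.obj (hF.obj_tensor X Y)).trans (hF'.obj_tensor _ _)
  map_tensor f g := by
    simp only [Functor.comp_map, hF.map_tensor, Functor.map_comp, eqToHom_map, hF'.map_tensor,
      Category.assoc, eqToHom_trans, eqToHom_trans_assoc]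

theorem conj_tensorHom {C : Type v} [Category.{u} C] [MonoidalCategory C] {X X' Y Y' Z W : C}
    (p : X' = X) (f : X ⟶ Y) (q : Y = Y') (g : Z ⟶ W) :
    ((eqToHom p ≫ f ≫ eqToHom q) ⊗ₘ g) =
      eqToHom (by rw [p]) ≫ (f ⊗ₘ g) ≫ eqToHom (by rw [q]) := by
  subst p q; simp

theorem tensorHom_conj {C : Type v} [Category.{u} C] [MonoidalCategory C] {X X' Y Y' Z W : C}
    (g : Z ⟶ W) (p : X' = X) (f : X ⟶ Y) (q : Y = Y') :
    (g ⊗ₘ (eqToHom p ≫ f ≫ eqToHom q)) =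
      eqToHom (by rw [p]) ≫ (g ⊗ₘ f) ≫ eqToHom (by rw [q]) := by
  subst p q; simp

theorem strict_assoc {C : Type v} [Category.{u} C] [MonoidalCategory C]
    [StrictMonoidalCategory C] {X₁ X₂ X₃ Y₁ Y₂ Y₃ : C}
    (f₁ : X₁ ⟶ Y₁) (f₂ : X₂ ⟶ Y₂) (f₃ : X₃ ⟶ Y₃) :
    ((f₁ ⊗ₘ f₂) ⊗ₘ f₃) = eqToHom (StrictMonoidalCategory.tensor_assoc X₁ X₂ X₃) ≫
      (f₁ ⊗ₘ (f₂ ⊗ₘ f₃)) ≫ eqToHom (StrictMonoidalCategory.tensor_assoc Y₁ Y₂ Y₃).symm := by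
  have h := associator_naturality f₁ f₂ f₃
  rw [StrictMonoidalCategory.associator_hom, StrictMonoidalCategory.associator_hom] at h
  rw [← Category.assoc, ← h]; simp

theorem strict_unit_left {C : Type v} [Category.{u} C] [MonoidalCategory C]
    [StrictMonoidalCategory C] {X Y : C} (f : X ⟶ Y) :
    (𝟙 (𝟙_ C) ⊗ₘ f) = eqToHom (StrictMonoidalCategory.unit_tensor X) ≫ f ≫
      eqToHom (StrictMonoidalCategory.unit_tensor Y).symm := by
  have h := leftUnitor_naturality f
  rw [StrictMonoidalCategory.leftUnitor_hom, StrictMonoidalCategory.leftUnitor_hom] at h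
  rw [id_tensorHom, ← Category.assoc, ← h]; simp

theorem strict_unit_right {C : Type v} [Category.{u} C] [MonoidalCategory C]
    [StrictMonoidalCategory C] {X Y : C} (f : X ⟶ Y) :
    (f ⊗ₘ 𝟙 (𝟙_ C)) = eqToHom (StrictMonoidalCategory.tensor_unit X) ≫ f ≫
      eqToHom (StrictMonoidalCategory.tensor_unit Y).symm := by
  have h := rightUnitor_naturality f
  rw [StrictMonoidalCategory.rightUnitor_hom, StrictMonoidalCategory.rightUnitor_hom] at h
  rw [tensorHom_id, ← Category.assoc, ← h]; simp

/-! ### Strict `k`-linear monoidal categories given by generators and relations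

Objects are words in the generating objects `O`, the tensor product of objects being
concatenation. Morphisms are formal `k`-linear combinations of formal composites and tensor
products of the generating morphisms `G` modulo the axioms of a strict `k`-linear monoidal
category and the given relations `R`. -/

/-- Formal morphism expressions. `str h` is the identity morphism of a word `a = b`. The
composition `comp f g` is in diagrammatic order (first `f`, then `g`). -/
inductive Term (k : Type u) {O : Type} (G : List O → List O → Type) :
    List O → List O → Type u
  | gen {a b : List O} (g : G a b) : Term k G a b
  | str {a b : List O} (h : a = b) : Term k G a b
  | comp {a b c : List O} (f : Term k G a b) (g : Term k G b c) : Term k G a c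
  | tensor {a b c d : List O} (f : Term k G a b) (g : Term k G c d) : Term k G (a ++ c) (b ++ d)
  | zero {a b : List O} : Term k G a b
  | add {a b : List O} (f g : Term k G a b) : Term k G a b
  | smul {a b : List O} (r : k) (f : Term k G a b) : Term k G a b

namespace Term

variable {k : Type u} {O : Type} {G : List O → List O → Type}

/-- The identity of a word. -/
abbrev one (a : List O) : Term k G a a := str rfl

/-- The formal difference. -/
abbrev sub [CommRing k] {a b : List O} (f g : Term k G a b) : Term k G a b :=
  add f (smul (-1) g)

/-- The smallest congruence containing the relations `R` and making words and expressions into a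
strict `k`-linear monoidal category. -/
inductive Rel [CommRing k] (R : ∀ a b : List O, Term k G a b → Term k G a b → Prop) :
    ∀ {a b : List O}, Term k G a b → Term k G a b → Prop
  | of {a b} {f g : Term k G a b} : R a b f g → Rel R f g
  -- congruence
  | refl {a b} (f : Term k G a b) : Rel R f f
  | symm {a b} {f g : Term k G a b} : Rel R f g → Rel R g f
  | trans {a b} {f g h : Term k G a b} : Rel R f g → Rel R g h → Rel R f h
  | comp_congr {a b c} {f f' : Term k G a b} {g g' : Term k G b c} :
      Rel R f f' → Rel R g g' → Rel R (comp f g) (comp f' g')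
  | tensor_congr {a b c d} {f f' : Term k G a b} {g g' : Term k G c d} :
      Rel R f f' → Rel R g g' → Rel R (tensor f g) (tensor f' g')
  | add_congr {a b} {f f' g g' : Term k G a b} :
      Rel R f f' → Rel R g g' → Rel R (add f g) (add f' g')
  | smul_congr {a b} (r : k) {f f' : Term k G a b} : Rel R f f' → Rel R (smul r f) (smul r f')
  -- category
  | one_comp {a b} (f : Term k G a b) : Rel R (comp (one a) f) f
  | comp_one {a b} (f : Term k G a b) : Rel R (comp f (one b)) f
  | assoc {a b c d} (f : Term k G a b) (g : Term k G b c) (h : Term k G c d) :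
      Rel R (comp (comp f g) h) (comp f (comp g h))
  -- strict monoidal category
  | tensor_one (a c : List O) : Rel R (tensor (one a) (one c)) (one (a ++ c))
  | tensor_comp {a b c a' b' c'} (f : Term k G a b) (g : Term k G b c)
      (f' : Term k G a' b') (g' : Term k G b' c') :
      Rel R (tensor (comp f g) (comp f' g')) (comp (tensor f f') (tensor g g'))
  | tensor_assoc {a b c a' b' c'} (f : Term k G a a') (g : Term k G b b') (h : Term k G c c') :
      Rel R (comp (tensor (tensor f g) h) (str (List.append_assoc a' b' c')))
        (comp (str (List.append_assoc a b c)) (tensor f (tensor g h)))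
  | unit_tensor {a b} (f : Term k G a b) : Rel R (tensor (one []) f) f
  | tensor_unit {a b} (f : Term k G a b) :
      Rel R (comp (tensor f (one [])) (str (List.append_nil b)))
        (comp (str (List.append_nil a)) f)
  -- the morphism spaces are `k`-modules
  | add_assoc {a b} (f g h : Term k G a b) : Rel R (add (add f g) h) (add f (add g h))
  | add_comm {a b} (f g : Term k G a b) : Rel R (add f g) (add g f)
  | zero_add {a b} (f : Term k G a b) : Rel R (add zero f) f
  | neg_add {a b} (f : Term k G a b) : Rel R (add (smul (-1) f) f) zero
  | smul_add {a b} (r : k) (f g : Term k G a b) :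
      Rel R (smul r (add f g)) (add (smul r f) (smul r g))
  | add_smul {a b} (r s : k) (f : Term k G a b) :
      Rel R (smul (r + s) f) (add (smul r f) (smul s f))
  | mul_smul {a b} (r s : k) (f : Term k G a b) : Rel R (smul (r * s) f) (smul r (smul s f))
  | one_smul {a b} (f : Term k G a b) : Rel R (smul 1 f) f
  -- composition and tensor product are bilinear
  | add_comp {a b c} (f f' : Term k G a b) (g : Term k G b c) :
      Rel R (comp (add f f') g) (add (comp f g) (comp f' g))
  | comp_add {a b c} (f : Term k G a b) (g g' : Term k G b c) :
      Rel R (comp f (add g g')) (add (comp f g) (comp f g'))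
  | smul_comp {a b c} (r : k) (f : Term k G a b) (g : Term k G b c) :
      Rel R (comp (smul r f) g) (smul r (comp f g))
  | comp_smul {a b c} (r : k) (f : Term k G a b) (g : Term k G b c) :
      Rel R (comp f (smul r g)) (smul r (comp f g))
  | add_tensor {a b c d} (f f' : Term k G a b) (g : Term k G c d) :
      Rel R (tensor (add f f') g) (add (tensor f g) (tensor f' g))
  | tensor_add {a b c d} (f : Term k G a b) (g g' : Term k G c d) :
      Rel R (tensor f (add g g')) (add (tensor f g) (tensor f g'))
  | smul_tensor {a b c d} (r : k) (f : Term k G a b) (g : Term k G c d) :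
      Rel R (tensor (smul r f) g) (smul r (tensor f g))
  | tensor_smul {a b c d} (r : k) (f : Term k G a b) (g : Term k G c d) :
      Rel R (tensor f (smul r g)) (smul r (tensor f g))

end Term

/-- The strict `k`-linear monoidal category with generating objects `O`, generating morphisms `G`
and relations `R`. -/
@[ext]
structure Pres {k : Type u} [CommRing k] {O : Type} {G : List O → List O → Type}
    (R : ∀ a b : List O, Term k G a b → Term k G a b → Prop) : Type where
  ofWord ::
  word : List O

namespace Pres

variable {k : Type u} [CommRing k] {O : Type} {G : List O → List O → Type}
  {R : ∀ a b : List O, Term k G a b → Term k G a b → Prop}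

/-- Morphisms are classes of expressions. -/
def Hom (X Y : Pres R) : Type u := Quot (Term.Rel R (a := X.word) (b := Y.word))

/-- The morphism represented by an expression. -/
def mk {a b : List O} (f : Term k G a b) : Hom (R := R) ⟨a⟩ ⟨b⟩ := Quot.mk _ f

theorem mk_eq {a b : List O} {f g : Term k G a b} (h : Term.Rel R f g) :
    mk (R := R) f = mk g := Quot.sound h

instance : Category.{u} (Pres R) where
  Hom := Hom
  id X := mk (Term.one X.word)
  comp f g := Quot.map₂ Term.comp (fun _ _ _ h => .comp_congr (.refl _) h)
    (fun _ _ _ h => .comp_congr h (.refl _)) f g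
  id_comp := by rintro _ _ ⟨f⟩; exact Quot.sound (.one_comp f)
  comp_id := by rintro _ _ ⟨f⟩; exact Quot.sound (.comp_one f)
  assoc := by rintro _ _ _ _ ⟨f⟩ ⟨g⟩ ⟨h⟩; exact Quot.sound (.assoc f g h)

/-- The morphism represented by an expression, as a morphism of the category. -/
abbrev hom {a b : List O} (f : Term k G a b) : (⟨a⟩ : Pres R) ⟶ ⟨b⟩ := mk f

instance (X Y : Pres R) : Zero (X ⟶ Y) where
  zero := hom (R := R) (Term.zero (a := X.word) (b := Y.word))

instance (X Y : Pres R) : Add (X ⟶ Y) where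
  add f g := Quot.map₂ Term.add (fun _ _ _ h => .add_congr (.refl _) h)
    (fun _ _ _ h => .add_congr h (.refl _)) f g

instance (X Y : Pres R) : Neg (X ⟶ Y) where
  neg f := Quot.map (Term.smul (-1)) (fun _ _ h => .smul_congr _ h) f

instance (X Y : Pres R) : AddCommGroup (X ⟶ Y) where
  add_assoc := by rintro ⟨f⟩ ⟨g⟩ ⟨h⟩; exact Quot.sound (.add_assoc f g h)
  zero_add := by rintro ⟨f⟩; exact Quot.sound (.zero_add f)
  add_zero := by
    rintro ⟨f⟩; exact Quot.sound (.trans (.add_comm _ _) (.zero_add f))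
  add_comm := by rintro ⟨f⟩ ⟨g⟩; exact Quot.sound (.add_comm f g)
  neg_add_cancel := by rintro ⟨f⟩; exact Quot.sound (.neg_add f)
  nsmul := nsmulRec
  zsmul := zsmulRec

instance (X Y : Pres R) : SMul k (X ⟶ Y) where
  smul r f := Quot.map (Term.smul r) (fun _ _ h => .smul_congr _ h) f

instance (X Y : Pres R) : Module k (X ⟶ Y) :=
  Module.ofMinimalAxioms
    (by rintro r ⟨f⟩ ⟨g⟩; exact Quot.sound (.smul_add r f g))
    (by rintro r s ⟨f⟩; exact Quot.sound (.add_smul r s f))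
    (by rintro r s ⟨f⟩; exact Quot.sound (.mul_smul r s f))
    (by rintro ⟨f⟩; exact Quot.sound (.one_smul f))

instance : Preadditive (Pres R) where
  add_comp := by rintro _ _ _ ⟨f⟩ ⟨f'⟩ ⟨g⟩; exact Quot.sound (.add_comp f f' g)
  comp_add := by rintro _ _ _ ⟨f⟩ ⟨g⟩ ⟨g'⟩; exact Quot.sound (.comp_add f g g')

instance : Linear k (Pres R) where
  smul_comp := by rintro _ _ _ r ⟨f⟩ ⟨g⟩; exact Quot.sound (.smul_comp r f g)
  comp_smul := by rintro _ _ _ ⟨f⟩ r ⟨g⟩; exact Quot.sound (.comp_smul r f g)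

theorem hom_str {a b : List O} (h : a = b) :
    hom (R := R) (Term.str h) = eqToHom (congrArg Pres.ofWord h) := by
  subst h; rfl

/-- The tensor product of morphisms. -/
def tensorHom' {X Y X' Y' : Pres R} (f : X ⟶ Y) (g : X' ⟶ Y') :
    (⟨X.word ++ X'.word⟩ : Pres R) ⟶ ⟨Y.word ++ Y'.word⟩ :=
  Quot.map₂ Term.tensor (fun _ _ _ h => .tensor_congr (.refl _) h)
    (fun _ _ _ h => .tensor_congr h (.refl _)) f g

theorem tensorHom'_eqToHom {X Y X' Y' : Pres R} (h : X = Y) (h' : X' = Y') :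
    tensorHom' (eqToHom h) (eqToHom h') = eqToHom (by rw [h, h']) := by
  subst h h'; exact Quot.sound (.tensor_one _ _)

theorem tensor_assoc' {X₁ X₂ X₃ Y₁ Y₂ Y₃ : Pres R} (f : X₁ ⟶ Y₁) (g : X₂ ⟶ Y₂) (h : X₃ ⟶ Y₃) :
    tensorHom' (tensorHom' f g) h ≫
        eqToHom (congrArg Pres.ofWord (List.append_assoc Y₁.word Y₂.word Y₃.word)) =
      eqToHom (congrArg Pres.ofWord (List.append_assoc X₁.word X₂.word X₃.word)) ≫
        tensorHom' f (tensorHom' g h) := by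
  rw [← hom_str (List.append_assoc _ _ _), ← hom_str (List.append_assoc _ _ _)]
  rcases f with ⟨f⟩; rcases g with ⟨g⟩; rcases h with ⟨h⟩
  exact Quot.sound (.tensor_assoc f g h)

theorem unit_tensor' {X Y : Pres R} (f : X ⟶ Y) :
    tensorHom' (𝟙 (⟨[]⟩ : Pres R)) f ≫
        eqToHom (congrArg Pres.ofWord (List.nil_append Y.word)) =
      eqToHom (congrArg Pres.ofWord (List.nil_append X.word)) ≫ f := by
  rcases f with ⟨f⟩
  refine (Category.comp_id _).trans (Eq.trans ?_ (Category.id_comp _).symm)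
  exact Quot.sound (.unit_tensor f)

theorem tensor_unit' {X Y : Pres R} (f : X ⟶ Y) :
    tensorHom' f (𝟙 (⟨[]⟩ : Pres R)) ≫
        eqToHom (congrArg Pres.ofWord (List.append_nil Y.word)) =
      eqToHom (congrArg Pres.ofWord (List.append_nil X.word)) ≫ f := by
  rw [← hom_str (List.append_nil _), ← hom_str (List.append_nil _)]
  rcases f with ⟨f⟩
  exact Quot.sound (.tensor_unit f)

theorem pentagon' {A A' B B' C C' D D' E : Pres R} (h₁ : A = A') (h₂ : B = B')
    (h₃ : (⟨A'.word ++ B'.word⟩ : Pres R) = ⟨C.word ++ D.word⟩) (h₄ : C = C') (h₅ : D = D')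
    (h₆ : (⟨A.word ++ B.word⟩ : Pres R) = E) (h₇ : E = ⟨C'.word ++ D'.word⟩) :
    tensorHom' (eqToHom h₁) (eqToHom h₂) ≫ eqToHom h₃ ≫ tensorHom' (eqToHom h₄) (eqToHom h₅) =
      eqToHom h₆ ≫ eqToHom h₇ := by
  rw [tensorHom'_eqToHom, tensorHom'_eqToHom]; simp

theorem triangle' {A A' B B' C C' : Pres R}
    (h₁ : (⟨C.word ++ C'.word⟩ : Pres R) = ⟨A.word ++ B.word⟩) (h₂ : A = A') (h₃ : B = B')
    (h₄ : C = A') (h₅ : C' = B') :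
    eqToHom h₁ ≫ tensorHom' (eqToHom h₂) (eqToHom h₃) =
      tensorHom' (eqToHom h₄) (eqToHom h₅) := by
  rw [tensorHom'_eqToHom, tensorHom'_eqToHom]; simp

instance : MonoidalCategoryStruct (Pres R) where
  tensorObj X Y := ⟨X.word ++ Y.word⟩
  tensorUnit := ⟨[]⟩
  tensorHom f g := tensorHom' f g
  whiskerLeft X _ _ f := tensorHom' (𝟙 X) f
  whiskerRight f Y := tensorHom' f (𝟙 Y)
  associator X Y Z := eqToIso (congrArg Pres.ofWord (List.append_assoc X.word Y.word Z.word))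
  leftUnitor X := eqToIso (congrArg Pres.ofWord (List.nil_append X.word))
  rightUnitor X := eqToIso (congrArg Pres.ofWord (List.append_nil X.word))

instance : MonoidalCategory (Pres R) :=
  MonoidalCategory.ofTensorHom
    (id_tensorHom_id := fun X Y => Quot.sound (.tensor_one _ _))
    (id_tensorHom := fun _ _ _ _ => rfl)
    (tensorHom_id := fun _ _ => rfl)
    (tensorHom_comp_tensorHom := by
      rintro _ _ _ _ _ _ ⟨f₁⟩ ⟨f₂⟩ ⟨g₁⟩ ⟨g₂⟩
      exact (Quot.sound (.tensor_comp f₁ g₁ f₂ g₂)).symm)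
    (associator_naturality := fun f g h => tensor_assoc' f g h)
    (leftUnitor_naturality := fun f => unit_tensor' f)
    (rightUnitor_naturality := fun f => tensor_unit' f)
    (pentagon := fun W X Y Z => pentagon'
      (congrArg ofWord (List.append_assoc W.word X.word Y.word)) (rfl : Z = Z)
      (congrArg ofWord (List.append_assoc W.word (X.word ++ Y.word) Z.word))
      (rfl : W = W) (congrArg ofWord (List.append_assoc X.word Y.word Z.word))
      (congrArg ofWord (List.append_assoc (W.word ++ X.word) Y.word Z.word))
      (congrArg ofWord (List.append_assoc W.word X.word (Y.word ++ Z.word))))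
    (triangle := fun X Y => triangle'
      (congrArg ofWord (List.append_assoc X.word [] Y.word))
      (rfl : X = X) (congrArg ofWord (List.nil_append Y.word))
      (congrArg ofWord (List.append_nil X.word)) (rfl : Y = Y))

instance : StrictMonoidalCategory (Pres R) where
  tensor_assoc X Y Z := congrArg Pres.ofWord (List.append_assoc X.word Y.word Z.word)
  unit_tensor X := congrArg Pres.ofWord (List.nil_append X.word)
  tensor_unit X := congrArg Pres.ofWord (List.append_nil X.word)
  associator_hom _ _ _ := rfl
  leftUnitor_hom _ := rfl
  rightUnitor_hom _ := rfl

theorem tensor_add' {X Y X' Y' : Pres R} (f : X ⟶ Y) (g g' : X' ⟶ Y') :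
    tensorHom' f (g + g') = tensorHom' f g + tensorHom' f g' := by
  rcases f with ⟨f⟩; rcases g with ⟨g⟩; rcases g' with ⟨g'⟩
  exact Quot.sound (.tensor_add f g g')

theorem add_tensor' {X Y X' Y' : Pres R} (f f' : X ⟶ Y) (g : X' ⟶ Y') :
    tensorHom' (f + f') g = tensorHom' f g + tensorHom' f' g := by
  rcases f with ⟨f⟩; rcases g with ⟨g⟩; rcases f' with ⟨f'⟩
  exact Quot.sound (.add_tensor f f' g)

instance : MonoidalPreadditive (Pres R) where
  whiskerLeft_zero {X Y Z} := by
    have h := tensor_add' (𝟙 X) (0 : Y ⟶ Z) 0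
    rw [add_zero] at h
    exact left_eq_add.mp h
  zero_whiskerRight {X Y Z} := by
    have h := add_tensor' (0 : Y ⟶ Z) 0 (𝟙 X)
    rw [add_zero] at h
    exact left_eq_add.mp h
  whiskerLeft_add f g := tensor_add' _ f g
  add_whiskerRight f g := add_tensor' f g _

instance : MonoidalLinear k (Pres R) where
  whiskerLeft_smul := by rintro X _ _ r ⟨f⟩; exact Quot.sound (.tensor_smul r _ f)
  smul_whiskerRight := by rintro r _ _ ⟨f⟩ X; exact Quot.sound (.smul_tensor r f _)

/-! The universal property: strict `k`-linear monoidal functors out of a presented category. -/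

section Lift

variable {D : Type v} [Category.{u} D] [Preadditive D] [Linear k D] [MonoidalCategory D]

/-- Evaluation of expressions in a `k`-linear monoidal category. -/
def eval (F : List O → D) (ht : ∀ a b, F (a ++ b) = F a ⊗ F b)
    (φ : ∀ {a b : List O}, G a b → (F a ⟶ F b)) :
    ∀ {a b : List O}, Term k G a b → (F a ⟶ F b)
  | _, _, .gen g => φ g
  | _, _, .str h => eqToHom (congrArg F h)
  | _, _, .comp f g => eval F ht φ f ≫ eval F ht φ g
  | _, _, .tensor f g =>
      eqToHom (ht _ _) ≫ (eval F ht φ f ⊗ₘ eval F ht φ g) ≫ eqToHom (ht _ _).symm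
  | _, _, .zero => 0
  | _, _, .add f g => eval F ht φ f + eval F ht φ g
  | _, _, .smul r f => r • eval F ht φ f

variable [MonoidalPreadditive D] [MonoidalLinear k D] [StrictMonoidalCategory D]

theorem eval_rel (F : List O → D) (hn : F [] = 𝟙_ D) (ht : ∀ a b, F (a ++ b) = F a ⊗ F b)
    (φ : ∀ {a b : List O}, G a b → (F a ⟶ F b))
    (hR : ∀ {a b : List O} {f g : Term k G a b}, R a b f g → eval F ht φ f = eval F ht φ g)
    {a b : List O} {f g : Term k G a b} (h : Term.Rel R f g) :
    eval F ht φ f = eval F ht φ g := by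
  induction h with
  | of h => exact hR h
  | refl => rfl
  | symm _ ih => exact ih.symm
  | trans _ _ ih ih' => exact ih.trans ih'
  | comp_congr _ _ ih ih' => simp only [eval, ih, ih']
  | tensor_congr _ _ ih ih' => simp only [eval, ih, ih']
  | add_congr _ _ ih ih' => simp only [eval, ih, ih']
  | smul_congr r _ ih => simp only [eval, ih]
  | one_comp f => simp [eval]
  | comp_one f => simp [eval]
  | assoc f g h => simp [eval]
  | tensor_one a c => simp [eval]
  | tensor_comp f g f' g' => simp only [eval, Category.assoc, eqToHom_trans_assoc, eqToHom_refl, Category.id_comp,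
      tensorHom_comp_tensorHom_assoc]
  | tensor_assoc f g h =>
    simp only [eval, conj_tensorHom, tensorHom_conj, strict_assoc, Category.assoc,
      eqToHom_trans, eqToHom_trans_assoc]
  | unit_tensor f =>
    have e : (𝟙 (F []) : F [] ⟶ F []) = eqToHom hn ≫ 𝟙 (𝟙_ D) ≫ eqToHom hn.symm := by simp
    simp only [eval, eqToHom_refl, e, conj_tensorHom, strict_unit_left, Category.assoc,
      eqToHom_trans, eqToHom_trans_assoc]
    exact (Category.id_comp _).trans (Category.comp_id _)
  | tensor_unit f =>
    have e : (𝟙 (F []) : F [] ⟶ F []) = eqToHom hn ≫ 𝟙 (𝟙_ D) ≫ eqToHom hn.symm := by simp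
    simp only [eval, eqToHom_refl, e, tensorHom_conj, strict_unit_right, Category.assoc,
      eqToHom_trans, eqToHom_trans_assoc]
    simp
  | add_assoc f g h => simp only [eval, _root_.add_assoc]
  | add_comm f g => simp only [eval, _root_.add_comm]
  | zero_add f => simp [eval]
  | neg_add f => simp [eval]
  | smul_add r f g => simp [eval]
  | add_smul r s f => simp [eval, _root_.add_smul]
  | mul_smul r s f => simp [eval, SemigroupAction.mul_smul]
  | one_smul f => simp [eval]
  | add_comp f f' g => simp [eval]
  | comp_add f g g' => simp [eval]
  | smul_comp r f g => simp [eval]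
  | comp_smul r f g => simp [eval]
  | add_tensor f f' g => simp [eval, MonoidalPreadditive.add_tensor]
  | tensor_add f g g' => simp [eval, MonoidalPreadditive.tensor_add]
  | smul_tensor r f g => simp [eval, MonoidalCategory.tensorHom_def]
  | tensor_smul r f g => simp [eval, MonoidalCategory.tensorHom_def]

/-- The functor out of a presented category determined by an interpretation of the generators
satisfying the relations. -/
def lift (F : List O → D) (hn : F [] = 𝟙_ D) (ht : ∀ a b, F (a ++ b) = F a ⊗ F b)
    (φ : ∀ {a b : List O}, G a b → (F a ⟶ F b))
    (hR : ∀ {a b : List O} {f g : Term k G a b}, R a b f g → eval F ht φ f = eval F ht φ g) :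
    Pres R ⥤ D where
  obj X := F X.word
  map f := Quot.lift (eval F ht φ) (fun _ _ h => eval_rel F hn ht φ hR h) f
  map_id _ := rfl
  map_comp := by rintro _ _ _ ⟨f⟩ ⟨g⟩; rfl

variable (F : List O → D) (hn : F [] = 𝟙_ D) (ht : ∀ a b, F (a ++ b) = F a ⊗ F b)
    (φ : ∀ {a b : List O}, G a b → (F a ⟶ F b))
    (hR : ∀ {a b : List O} {f g : Term k G a b}, R a b f g → eval F ht φ f = eval F ht φ g)

instance : (lift F hn ht φ hR).Additive where
  map_add := by rintro _ _ ⟨f⟩ ⟨g⟩; rfl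

instance : (lift F hn ht φ hR).Linear k where
  map_smul := by rintro _ _ ⟨f⟩ r; rfl

theorem lift_isStrictMonoidal : IsStrictMonoidal (lift F hn ht φ hR) where
  obj_unit := hn
  obj_tensor X Y := ht X.word Y.word
  map_tensor := by rintro _ _ _ _ ⟨f⟩ ⟨g⟩; rfl

end Lift

end Pres

/-! ### The additive envelope -/

/-- Objects of the additive envelope are finite formal direct sums `X 0 ⊕ ⋯ ⊕ X (n - 1)`. -/
structure AddEnv (C : Type v) : Type v where
  n : ℕ
  X : Fin n → C

namespace AddEnv

theorem obj_ext {C : Type v} {A B : AddEnv C} (hn : A.n = B.n) (hX : ∀ i, A.X i = B.X (Fin.cast hn i)) :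
    A = B := by
  obtain ⟨n, X⟩ := A
  obtain ⟨n', X'⟩ := B
  obtain rfl : n = n' := hn
  obtain rfl : X = X' := funext hX
  rfl

theorem n_eq {C : Type v} {A B : AddEnv C} (h : A = B) : A.n = B.n := congrArg AddEnv.n h

theorem X_eq {C : Type v} {A B : AddEnv C} (h : A = B) (i : Fin A.n) : A.X i = B.X (Fin.cast (n_eq h) i) := by
  subst h; rfl

theorem X_eq' {C : Type v} {A B : AddEnv C} (h : A = B) (j : Fin B.n) :
    A.X (Fin.cast (n_eq h).symm j) = B.X j := by
  subst h; rfl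

theorem fin_eq_iff {a b : ℕ} (p q : Fin (a * b)) :
    p = q ↔ p.divNat = q.divNat ∧ p.modNat = q.modNat := by
  rw [← (finProdFinEquiv (m := a) (n := b)).symm.injective.eq_iff]
  exact Prod.ext_iff

theorem fin_div_div {a b c : ℕ} (p : Fin (a * b * c)) :
    p.divNat.divNat = (Fin.cast (Nat.mul_assoc a b c) p).divNat := by
  apply Fin.ext
  simp [Fin.coe_divNat, Nat.div_div_eq_div_mul, Nat.mul_comm]

theorem fin_div_mod {a b c : ℕ} (p : Fin (a * b * c)) :
    p.divNat.modNat = (Fin.cast (Nat.mul_assoc a b c) p).modNat.divNat := by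
  apply Fin.ext
  simp [Fin.coe_divNat, Fin.coe_modNat, Nat.mod_mul_left_div_self]

theorem fin_mod_mod {a b c : ℕ} (p : Fin (a * b * c)) :
    p.modNat = (Fin.cast (Nat.mul_assoc a b c) p).modNat.modNat := by
  apply Fin.ext
  simp [Fin.coe_modNat]

theorem fin_one_mul {a : ℕ} (p : Fin (1 * a)) : p.modNat = Fin.cast (Nat.one_mul a) p := by
  apply Fin.ext
  have := p.2
  simp only [Fin.coe_modNat, Fin.val_cast]
  exact Nat.mod_eq_of_lt (by simpa using this)

theorem fin_mul_one {a : ℕ} (p : Fin (a * 1)) : p.divNat = Fin.cast (Nat.mul_one a) p := by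
  apply Fin.ext
  simp [Fin.coe_divNat]

variable {C : Type v} [Category.{u} C] [Preadditive C]

/-- Morphisms are matrices of morphisms. -/
def Hom (A B : AddEnv C) : Type u := ∀ (i : Fin A.n) (j : Fin B.n), A.X i ⟶ B.X j

instance : Category.{u} (AddEnv C) where
  Hom := Hom
  id A := fun i j => if h : i = j then eqToHom (congrArg A.X h) else 0
  comp {A B D} f g := fun i l => ∑ j : Fin B.n, f i j ≫ g j l
  id_comp f := by
    funext i j; simp [dite_comp]
  comp_id f := by
    funext i j; simp [comp_dite]
  assoc f g h := by
    funext i j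
    simp only [Preadditive.sum_comp, Preadditive.comp_sum, Category.assoc]
    rw [Finset.sum_comm]

/-- The matrix entry from the `i`th to the `j`th summand. -/
def entry {A B : AddEnv C} (f : A ⟶ B) (i : Fin A.n) (j : Fin B.n) : A.X i ⟶ B.X j := f i j

/-- The morphism with given matrix entries. -/
def ofMatrix {A B : AddEnv C} (f : ∀ (i : Fin A.n) (j : Fin B.n), A.X i ⟶ B.X j) : A ⟶ B := f

@[simp] theorem entry_ofMatrix {A B : AddEnv C}
    (f : ∀ (i : Fin A.n) (j : Fin B.n), A.X i ⟶ B.X j) (i : Fin A.n) (j : Fin B.n) :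
    entry (ofMatrix f) i j = f i j := rfl

@[ext] theorem hom_ext {A B : AddEnv C} {f g : A ⟶ B} (h : ∀ i j, entry f i j = entry g i j) :
    f = g := by
  funext i j; exact h i j

@[simp] theorem comp_entry {A B D : AddEnv C} (f : A ⟶ B) (g : B ⟶ D) (i : Fin A.n)
    (l : Fin D.n) : entry (f ≫ g) i l = ∑ j, entry f i j ≫ entry g j l := rfl

theorem id_entry {A : AddEnv C} (i j : Fin A.n) :
    entry (𝟙 A) i j = if h : i = j then eqToHom (congrArg A.X h) else 0 := rfl

instance (A B : AddEnv C) : AddCommGroup (A ⟶ B) :=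
  inferInstanceAs (AddCommGroup (∀ (i : Fin A.n) (j : Fin B.n), A.X i ⟶ B.X j))

@[simp] theorem add_entry {A B : AddEnv C} (f g : A ⟶ B) (i : Fin A.n) (j : Fin B.n) :
    entry (f + g) i j = entry f i j + entry g i j := rfl

@[simp] theorem zero_entry {A B : AddEnv C} (i : Fin A.n) (j : Fin B.n) :
    entry (0 : A ⟶ B) i j = 0 := rfl

instance : Preadditive (AddEnv C) where
  add_comp f g h := by intros; ext i j; simp [Finset.sum_add_distrib]
  comp_add f g h := by intros; ext i j; simp [Finset.sum_add_distrib]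

instance {k : Type w} [CommRing k] [Linear k C] (A B : AddEnv C) : Module k (A ⟶ B) :=
  inferInstanceAs (Module k (∀ (i : Fin A.n) (j : Fin B.n), A.X i ⟶ B.X j))

@[simp] theorem smul_entry {k : Type w} [CommRing k] [Linear k C] {A B : AddEnv C} (r : k)
    (f : A ⟶ B) (i : Fin A.n) (j : Fin B.n) : entry (r • f) i j = r • entry f i j := rfl

instance {k : Type w} [CommRing k] [Linear k C] : Linear k (AddEnv C) where
  smul_comp := by intros; ext i j; simp [Finset.smul_sum]
  comp_smul := by intros; ext i j; simp [Finset.smul_sum]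

/-- The canonical extension of an additive functor to additive envelopes. -/
def map {D : Type w} [Category.{u} D] [Preadditive D] (F : C ⥤ D) [F.Additive] :
    AddEnv C ⥤ AddEnv D where
  obj A := ⟨A.n, fun i => F.obj (A.X i)⟩
  map f := ofMatrix fun i j => F.map (entry f i j)
  map_id A := by
    ext i j
    simp only [entry_ofMatrix, id_entry]
    split_ifs with h
    · rw [eqToHom_map]
    · simp
  map_comp f g := by
    ext i j
    simp [Functor.map_sum]

theorem comp_eqToHom_entry {A B D : AddEnv C} (f : A ⟶ B) (h : B = D) (i : Fin A.n)
    (l : Fin D.n) :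
    entry (f ≫ eqToHom h) i l = entry f i (Fin.cast (n_eq h).symm l) ≫ eqToHom (X_eq' h l) := by
  subst h; simp

theorem comp_eqToHom_entry' {A B D : AddEnv C} (f : A ⟶ B) (h : B = D) (i : Fin A.n)
    (l : Fin B.n) :
    entry (f ≫ eqToHom h) i (Fin.cast (n_eq h) l) = entry f i l ≫ eqToHom (X_eq h l) := by
  subst h; simp

theorem eqToHom_comp_entry {A B D : AddEnv C} (h : A = B) (f : B ⟶ D) (i : Fin A.n)
    (l : Fin D.n) :
    entry (eqToHom h ≫ f) i l = eqToHom (X_eq h i) ≫ entry f (Fin.cast (n_eq h) i) l := by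
  subst h; simp

theorem entry_congr {A B : AddEnv C} (f : A ⟶ B) {i i' : Fin A.n} {j j' : Fin B.n}
    (hi : i = i') (hj : j = j') :
    entry f i j = eqToHom (congrArg A.X hi) ≫ entry f i' j' ≫ eqToHom (congrArg B.X hj.symm) := by
  subst hi hj; simp

/-- A morphism which merely reorders the summands: for some bijection `e` of the index sets, the
`i`th summand of the source equals the `e i`th summand of the target and is mapped to it by the
identity, all other matrix entries being zero. -/
def IsReordering {A B : AddEnv C} (f : A ⟶ B) : Prop :=
  ∃ (e : Fin A.n ≃ Fin B.n) (h : ∀ i, A.X i = B.X (e i)),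
    f = ofMatrix fun i j => if hij : e i = j then
      eqToHom ((h i).trans (congrArg B.X hij)) else 0

section Tensor

variable [MonoidalCategory C]

/-- The tensor product of formal direct sums is given by distributivity, with the summands
`X i ⊗ Y j` in lexicographic order. -/
abbrev tensorObj' (A B : AddEnv C) : AddEnv C := ⟨A.n * B.n, fun p => A.X p.divNat ⊗ B.X p.modNat⟩

/-- The Kronecker product of matrices. -/
def tensorHom' {A B A' B' : AddEnv C} (f : A ⟶ B) (g : A' ⟶ B') :
    tensorObj' A A' ⟶ tensorObj' B B' :=
  ofMatrix fun p q => entry f p.divNat q.divNat ⊗ₘ entry g p.modNat q.modNat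

/-- The unit object, a formal direct sum with one summand. -/
abbrev tensorUnit' : AddEnv C := ⟨1, fun _ => 𝟙_ C⟩

section Strict

variable [StrictMonoidalCategory C]

theorem tensorObj_assoc (A B D : AddEnv C) :
    tensorObj' (tensorObj' A B) D = tensorObj' A (tensorObj' B D) :=
  obj_ext (Nat.mul_assoc A.n B.n D.n) fun p => by
    change (A.X p.divNat.divNat ⊗ B.X p.divNat.modNat) ⊗ D.X p.modNat = _
    rw [fin_div_div, fin_div_mod, fin_mod_mod, StrictMonoidalCategory.tensor_assoc]

theorem unit_tensorObj (A : AddEnv C) : tensorObj' tensorUnit' A = A :=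
  obj_ext (Nat.one_mul A.n) fun p => by
    change 𝟙_ C ⊗ A.X p.modNat = _
    rw [fin_one_mul, StrictMonoidalCategory.unit_tensor]

theorem tensorObj_unit (A : AddEnv C) : tensorObj' A tensorUnit' = A :=
  obj_ext (Nat.mul_one A.n) fun p => by
    change A.X p.divNat ⊗ 𝟙_ C = _
    rw [fin_mul_one, StrictMonoidalCategory.tensor_unit]

instance : MonoidalCategoryStruct (AddEnv C) where
  tensorObj := tensorObj'
  tensorUnit := tensorUnit'
  tensorHom := tensorHom'
  whiskerLeft A _ _ f := tensorHom' (𝟙 A) f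
  whiskerRight f B := tensorHom' f (𝟙 B)
  associator A B D := eqToIso (tensorObj_assoc A B D)
  leftUnitor A := eqToIso (unit_tensorObj A)
  rightUnitor A := eqToIso (tensorObj_unit A)

variable [MonoidalPreadditive C]

theorem tensorHom'_id (A B : AddEnv C) : tensorHom' (𝟙 A) (𝟙 B) = 𝟙 (tensorObj' A B) := by
  ext p q
  simp only [tensorHom', entry_ofMatrix, id_entry]
  by_cases h : p = q
  · subst h; simp
  · rw [dif_neg h]
    rw [fin_eq_iff, not_and_or] at h
    rcases h with h | h
    · rw [dif_neg h, MonoidalPreadditive.zero_tensor]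
    · rw [dif_neg h, MonoidalPreadditive.tensor_zero]

theorem tensorHom'_comp {A B D A' B' D' : AddEnv C} (f : A ⟶ B) (g : B ⟶ D) (f' : A' ⟶ B')
    (g' : B' ⟶ D') :
    tensorHom' (f ≫ g) (f' ≫ g') = tensorHom' f f' ≫ tensorHom' g g' := by
  ext p q
  simp only [tensorHom', entry_ofMatrix, comp_entry, sum_tensor, tensor_sum,
    tensorHom_comp_tensorHom]
  symm
  exact (finProdFinEquiv.symm.sum_comp (fun x : Fin B.n × Fin B'.n =>
    (entry f p.divNat x.1 ≫ entry g x.1 q.divNat) ⊗ₘ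
      (entry f' p.modNat x.2 ≫ entry g' x.2 q.modNat))).trans (Fintype.sum_prod_type_right _)

theorem tensorHom'_eqToHom {A A' B B' : AddEnv C} (h : A = A') (h' : B = B') :
    tensorHom' (eqToHom h) (eqToHom h') = eqToHom (by rw [h, h']) := by
  subst h h'; exact tensorHom'_id _ _

theorem pentagon' {A A' B B' D D' E E' T : AddEnv C} (h₁ : A = A') (h₂ : B = B')
    (h₃ : tensorObj' A' B' = tensorObj' D E) (h₄ : D = D') (h₅ : E = E')
    (h₆ : tensorObj' A B = T) (h₇ : T = tensorObj' D' E') :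
    tensorHom' (eqToHom h₁) (eqToHom h₂) ≫ eqToHom h₃ ≫ tensorHom' (eqToHom h₄) (eqToHom h₅) =
      eqToHom h₆ ≫ eqToHom h₇ := by
  rw [tensorHom'_eqToHom, tensorHom'_eqToHom]; simp

theorem triangle' {A A' B B' D D' : AddEnv C}
    (h₁ : tensorObj' D D' = tensorObj' A B) (h₂ : A = A') (h₃ : B = B')
    (h₄ : D = A') (h₅ : D' = B') :
    eqToHom h₁ ≫ tensorHom' (eqToHom h₂) (eqToHom h₃) =
      tensorHom' (eqToHom h₄) (eqToHom h₅) := by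
  rw [tensorHom'_eqToHom, tensorHom'_eqToHom]; simp

theorem tensorHom'_assoc {A₁ A₂ A₃ B₁ B₂ B₃ : AddEnv C} (f : A₁ ⟶ B₁) (g : A₂ ⟶ B₂)
    (h : A₃ ⟶ B₃) :
    tensorHom' (tensorHom' f g) h ≫ eqToHom (tensorObj_assoc B₁ B₂ B₃) =
      eqToHom (tensorObj_assoc A₁ A₂ A₃) ≫ tensorHom' f (tensorHom' g h) := by
  ext p q
  obtain ⟨q, rfl⟩ : ∃ q', q = Fin.cast (n_eq (tensorObj_assoc B₁ B₂ B₃)) q' :=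
    ⟨Fin.cast (n_eq (tensorObj_assoc B₁ B₂ B₃)).symm q, rfl⟩
  rw [comp_eqToHom_entry', eqToHom_comp_entry]
  simp only [tensorHom', entry_ofMatrix]
  rw [strict_assoc, entry_congr f (fin_div_div p) (fin_div_div q),
    entry_congr g (fin_div_mod p) (fin_div_mod q), entry_congr h (fin_mod_mod p) (fin_mod_mod q)]
  simp only [conj_tensorHom, tensorHom_conj, Category.assoc, eqToHom_trans, eqToHom_trans_assoc]
  simp

theorem tensorHom'_unit_left {A B : AddEnv C} (f : A ⟶ B) :
    tensorHom' (𝟙 (tensorUnit' : AddEnv C)) f ≫ eqToHom (unit_tensorObj B) =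
      eqToHom (unit_tensorObj A) ≫ f := by
  ext p q
  obtain ⟨q, rfl⟩ : ∃ q', q = Fin.cast (n_eq (unit_tensorObj B)) q' :=
    ⟨Fin.cast (n_eq (unit_tensorObj B)).symm q, rfl⟩
  rw [comp_eqToHom_entry', eqToHom_comp_entry]
  simp only [tensorHom', entry_ofMatrix, id_entry]
  rw [dif_pos (Subsingleton.elim _ _), eqToHom_refl, strict_unit_left,
    entry_congr f (fin_one_mul p) (fin_one_mul q)]
  simp

theorem tensorHom'_unit_right {A B : AddEnv C} (f : A ⟶ B) :
    tensorHom' f (𝟙 (tensorUnit' : AddEnv C)) ≫ eqToHom (tensorObj_unit B) =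
      eqToHom (tensorObj_unit A) ≫ f := by
  ext p q
  obtain ⟨q, rfl⟩ : ∃ q', q = Fin.cast (n_eq (tensorObj_unit B)) q' :=
    ⟨Fin.cast (n_eq (tensorObj_unit B)).symm q, rfl⟩
  rw [comp_eqToHom_entry', eqToHom_comp_entry]
  simp only [tensorHom', entry_ofMatrix, id_entry]
  rw [dif_pos (Subsingleton.elim _ _), eqToHom_refl, strict_unit_right,
    entry_congr f (fin_mul_one p) (fin_mul_one q)]
  simp

instance : MonoidalCategory (AddEnv C) :=
  MonoidalCategory.ofTensorHom
    (id_tensorHom_id := fun A B => tensorHom'_id A B)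
    (id_tensorHom := fun _ _ _ _ => rfl)
    (tensorHom_id := fun _ _ => rfl)
    (tensorHom_comp_tensorHom := fun f f' g g' => (tensorHom'_comp f g f' g').symm)
    (associator_naturality := fun f g h => tensorHom'_assoc f g h)
    (leftUnitor_naturality := fun f => tensorHom'_unit_left f)
    (rightUnitor_naturality := fun f => tensorHom'_unit_right f)
    (pentagon := fun W X Y Z => pentagon'
      (tensorObj_assoc W X Y) (rfl : Z = Z) (tensorObj_assoc W (tensorObj' X Y) Z)
      (rfl : W = W) (tensorObj_assoc X Y Z) (tensorObj_assoc (tensorObj' W X) Y Z)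
      (tensorObj_assoc W X (tensorObj' Y Z)))
    (triangle := fun X Y => triangle' (tensorObj_assoc X tensorUnit' Y)
      (rfl : X = X) (unit_tensorObj Y) (tensorObj_unit X) (rfl : Y = Y))

instance : StrictMonoidalCategory (AddEnv C) where
  tensor_assoc := tensorObj_assoc
  unit_tensor := unit_tensorObj
  tensor_unit := tensorObj_unit
  associator_hom _ _ _ := rfl
  leftUnitor_hom _ := rfl
  rightUnitor_hom _ := rfl

theorem tensorHom_entry {A B A' B' : AddEnv C} (f : A ⟶ B) (g : A' ⟶ B')
    (p : Fin (A ⊗ A').n) (q : Fin (B ⊗ B').n) :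
    entry (f ⊗ₘ g) p q = (entry f (Fin.divNat (m := A.n) (n := A'.n) p)
      (Fin.divNat (m := B.n) (n := B'.n) q) ⊗ₘ
      entry g (Fin.modNat (m := A.n) (n := A'.n) p) (Fin.modNat (m := B.n) (n := B'.n) q)) :=
  rfl

instance : MonoidalPreadditive (AddEnv C) where
  whiskerLeft_zero := by intros; ext p q; exact MonoidalPreadditive.tensor_zero _
  zero_whiskerRight := by intros; ext p q; exact MonoidalPreadditive.zero_tensor _
  whiskerLeft_add := by intros; ext p q; exact MonoidalPreadditive.tensor_add _ _ _
  add_whiskerRight := by intros; ext p q; exact MonoidalPreadditive.add_tensor _ _ _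

instance {k : Type w} [CommRing k] [Linear k C] [MonoidalLinear k C] :
    MonoidalLinear k (AddEnv C) where
  whiskerLeft_smul A _ _ r f := by
    ext p q
    change (entry (𝟙 A) _ _ ⊗ₘ (r • entry f _ _)) = r • (entry (𝟙 A) _ _ ⊗ₘ entry f _ _)
    simp [MonoidalCategory.tensorHom_def]
  smul_whiskerRight r _ _ f A := by
    ext p q
    change ((r • entry f _ _) ⊗ₘ entry (𝟙 A) _ _) = r • (entry f _ _ ⊗ₘ entry (𝟙 A) _ _)
    simp [MonoidalCategory.tensorHom_def]

theorem map_isStrictMonoidal {D : Type w} [Category.{u} D] [Preadditive D] [MonoidalCategory D]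
    [StrictMonoidalCategory D] [MonoidalPreadditive D] (F : C ⥤ D) [F.Additive]
    (hF : IsStrictMonoidal F) : IsStrictMonoidal (map F) where
  obj_unit := obj_ext rfl fun _ => hF.obj_unit
  obj_tensor A B := obj_ext rfl fun _ => hF.obj_tensor _ _
  map_tensor f g := by
    ext p q
    rw [eqToHom_comp_entry, comp_eqToHom_entry]
    exact hF.map_tensor _ _

end Strict

end Tensor

end AddEnv

/-! ### The degenerate affine Hecke category -/

/-- Generating morphisms of the degenerate affine Hecke category: the dot and the crossing. The
generating object is an upward string. -/
inductive AHGen : List Unit → List Unit → Type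
  | dot : AHGen [()] [()]
  | cross : AHGen [(), ()] [(), ()]

namespace AH

variable {k : Type u} [CommRing k]

/-- The string `↑`. -/
abbrev str : Term k AHGen [()] [()] := .one [()]

/-- The dot. -/
abbrev x : Term k AHGen [()] [()] := .gen .dot

/-- The crossing. -/
abbrev s : Term k AHGen [(), ()] [(), ()] := .gen .cross

/-- The dot on the left of two strings. -/
abbrev x₁ : Term k AHGen [(), ()] [(), ()] := .tensor x str

/-- The dot on the right of two strings. -/
abbrev x₂ : Term k AHGen [(), ()] [(), ()] := .tensor str x

/-- The crossing of the two left strings of three. -/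
abbrev s₁ : Term k AHGen [(), (), ()] [(), (), ()] := .tensor s str

/-- The crossing of the two right strings of three. -/
abbrev s₂ : Term k AHGen [(), (), ()] [(), (), ()] := .tensor str s

end AH

/-- Defining relations of the degenerate affine Hecke category. Diagrams are read from bottom to
top, `Term.comp f g` having `f` at the bottom. -/
inductive AHRel (k : Type u) [CommRing k] :
    ∀ a b : List Unit, Term k AHGen a b → Term k AHGen a b → Prop
  | quadratic : AHRel k _ _ (.comp AH.s AH.s) (.one [(), ()])
  | braid : AHRel k _ _ (.comp AH.s₁ (.comp AH.s₂ AH.s₁)) (.comp AH.s₂ (.comp AH.s₁ AH.s₂))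
  | dot_cross : AHRel k _ _ (.comp AH.x₁ AH.s) (.add (.comp AH.s AH.x₂) (.one [(), ()]))
  | cross_dot : AHRel k _ _ (.comp AH.s AH.x₁) (.add (.comp AH.x₂ AH.s) (.one [(), ()]))

/-- The degenerate affine Hecke category. -/
abbrev AH (k : Type u) [CommRing k] : Type := Pres (AHRel k)

namespace AH

variable (k : Type u) [CommRing k]

/-- The generating object `↑`. -/
abbrev up : AH k := ⟨[()]⟩

/-- The dot, as a morphism. -/
def dot : up k ⟶ up k := Pres.hom x

/-- The crossing, as a morphism. -/
def crossing : up k ⊗ up k ⟶ up k ⊗ up k := Pres.hom s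

end AH

/-! ### The localized symmetric product of two copies of the degenerate affine Hecke category

The symmetric product of two strict `k`-linear monoidal categories is obtained from their free
product by adjoining isomorphisms `X ⊗ Y ≅ Y ⊗ X`, for `X` in the first and `Y` in the second one,
which are natural and multiplicative in both variables. Multiplicativity expresses all of them
through the ones for the generating objects, so that one two-colour crossing and its inverse have
to be adjoined, and naturality has to be imposed for the generating morphisms only. -/

/-- The two colours. -/
inductive Colour
  | blue
  | red

open Colour

/-- Interchange of the colours. -/
def Colour.flip : Colour → Colour
  | blue => red
  | red => blue

/-- Generating morphisms: a dot and a crossing of each colour, the two-colour crossings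
`swap : blue ⊗ red ⟶ red ⊗ blue` and `swapInv`, and the dumbbell on `blue ⊗ red`. -/
inductive AHAHGen : List Colour → List Colour → Type
  | dot (c : Colour) : AHAHGen [c] [c]
  | cross (c : Colour) : AHAHGen [c, c] [c, c]
  | swap : AHAHGen [blue, red] [red, blue]
  | swapInv : AHAHGen [red, blue] [blue, red]
  | dumbbell : AHAHGen [blue, red] [blue, red]

namespace AHAH

variable {k : Type u} [CommRing k]

/-- The string of colour `c`. -/
abbrev str (c : Colour) : Term k AHAHGen [c] [c] := .one [c]

/-- The dot of colour `c`. -/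
abbrev x (c : Colour) : Term k AHAHGen [c] [c] := .gen (.dot c)

/-- The crossing of two strings of colour `c`. -/
abbrev s (c : Colour) : Term k AHAHGen [c, c] [c, c] := .gen (.cross c)

/-- The two-colour crossing `blue ⊗ red ⟶ red ⊗ blue`. -/
abbrev σ : Term k AHAHGen [blue, red] [red, blue] := .gen .swap

/-- The two-colour crossing `red ⊗ blue ⟶ blue ⊗ red`. -/
abbrev τ : Term k AHAHGen [red, blue] [blue, red] := .gen .swapInv

/-- The dumbbell on `blue ⊗ red`. -/
abbrev d : Term k AHAHGen [blue, red] [blue, red] := .gen .dumbbell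

/-- The dot on the left of two strings of colours `c` and `c'`. -/
abbrev x₁ (c c' : Colour) : Term k AHAHGen [c, c'] [c, c'] := .tensor (x c) (str c')

/-- The dot on the right of two strings of colours `c` and `c'`. -/
abbrev x₂ (c c' : Colour) : Term k AHAHGen [c, c'] [c, c'] := .tensor (str c) (x c')

/-- The one-colour crossing of the two left strings of three. -/
abbrev s₁ (c c' : Colour) : Term k AHAHGen [c, c, c'] [c, c, c'] := .tensor (s c) (str c')

/-- The one-colour crossing of the two right strings of three. -/
abbrev s₂ (c c' : Colour) : Term k AHAHGen [c, c', c'] [c, c', c'] := .tensor (str c) (s c')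

/-- A red string crossing two blue strings from right to left. -/
abbrev σbbr : Term k AHAHGen [blue, blue, red] [red, blue, blue] :=
  .comp (b := [blue, red, blue]) (.tensor (str blue) σ) (.tensor σ (str blue))

/-- A blue string crossing two red strings from left to right. -/
abbrev σbrr : Term k AHAHGen [blue, red, red] [red, red, blue] :=
  .comp (b := [red, blue, red]) (.tensor σ (str red)) (.tensor (str red) σ)

/-- A blue string crossing two red strings from right to left. -/
abbrev τrrb : Term k AHAHGen [red, red, blue] [blue, red, red] :=
  .comp (b := [red, blue, red]) (.tensor (str red) τ) (.tensor τ (str red))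

/-- A red string crossing two blue strings from left to right. -/
abbrev τrbb : Term k AHAHGen [red, blue, blue] [blue, blue, red] :=
  .comp (b := [blue, red, blue]) (.tensor τ (str blue)) (.tensor (str blue) τ)

/-- The dotted dumbbell on `blue ⊗ red`: the red dot minus the blue dot. -/
abbrev dotted : Term k AHAHGen [blue, red] [blue, red] := .sub (x₂ blue red) (x₁ blue red)

end AHAH

open AHAH in
/-- Defining relations of the localized symmetric product. -/
inductive AHAHRel (k : Type u) [CommRing k] :
    ∀ a b : List Colour, Term k AHAHGen a b → Term k AHAHGen a b → Prop
  -- the relations of the degenerate affine Hecke category in each colour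
  | quadratic (c : Colour) : AHAHRel k _ _ (.comp (s c) (s c)) (.one [c, c])
  | braid (c : Colour) : AHAHRel k _ _ (.comp (s₁ c c) (.comp (s₂ c c) (s₁ c c)))
      (.comp (s₂ c c) (.comp (s₁ c c) (s₂ c c)))
  | dot_cross (c : Colour) : AHAHRel k _ _ (.comp (x₁ c c) (s c))
      (.add (.comp (s c) (x₂ c c)) (.one [c, c]))
  | cross_dot (c : Colour) : AHAHRel k _ _ (.comp (s c) (x₁ c c))
      (.add (.comp (x₂ c c) (s c)) (.one [c, c]))
  -- the two-colour crossings are mutually inverse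
  | swap_swapInv : AHAHRel k _ _ (.comp σ τ) (.one [blue, red])
  | swapInv_swap : AHAHRel k _ _ (.comp τ σ) (.one [red, blue])
  -- the two-colour crossing is natural: dots and crossings of one colour slide through strings of
  -- the other colour
  | blue_dot_swap : AHAHRel k _ _ (.comp (x₁ blue red) σ) (.comp σ (x₂ red blue))
  | red_dot_swap : AHAHRel k _ _ (.comp (x₂ blue red) σ) (.comp σ (x₁ red blue))
  | blue_cross_swap : AHAHRel k _ _ (.comp (s₁ blue red) σbbr) (.comp σbbr (s₂ red blue))
  | red_cross_swap : AHAHRel k _ _ (.comp (s₂ blue red) σbrr) (.comp σbrr (s₁ red blue))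
  -- localization: the dumbbell is a two-sided inverse of the dotted dumbbell
  | dotted_dumbbell : AHAHRel k _ _ (.comp dotted d) (.one [blue, red])
  | dumbbell_dotted : AHAHRel k _ _ (.comp d dotted) (.one [blue, red])

/-- The symmetric product of a blue and a red copy of the degenerate affine Hecke category,
localized at the dotted dumbbell. -/
abbrev AHAH (k : Type u) [CommRing k] : Type := Pres (AHAHRel k)

namespace AHAH

variable (k : Type u) [CommRing k]

/-- The generating object of colour `c`. -/
abbrev up (c : Colour) : AHAH k := ⟨[c]⟩

/-- The dot of colour `c`, as a morphism. -/
def dot (c : Colour) : up k c ⟶ up k c := Pres.hom (x c)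

/-- The crossing with bottom-left string of colour `c` and bottom-right string of colour `c'`. -/
def crossing : ∀ c c' : Colour, up k c ⊗ up k c' ⟶ up k c' ⊗ up k c
  | blue, blue => Pres.hom (s blue)
  | red, red => Pres.hom (s red)
  | blue, red => Pres.hom σ
  | red, blue => Pres.hom τ

/-- The dumbbell on `blue ⊗ red`. -/
def dumbbellBR : up k blue ⊗ up k red ⟶ up k blue ⊗ up k red := Pres.hom d

/-- The dumbbell on `red ⊗ blue`, the inverse of the dotted dumbbell (red dot minus blue dot) on
`red ⊗ blue`. -/
def dumbbellRB : up k red ⊗ up k blue ⟶ up k red ⊗ up k blue :=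
  crossing k red blue ≫ dumbbellBR k ≫ crossing k blue red

/-! The involution `η`: switch the colours and multiply by `-1` for each dumbbell. -/

/-- Interchange of the colours of the strings of an object. -/
abbrev flipObj (a : List Colour) : AHAH k := ⟨a.map Colour.flip⟩

theorem flipObj_append (a b : List Colour) : flipObj k (a ++ b) = flipObj k a ⊗ flipObj k b :=
  congrArg Pres.ofWord List.map_append

/-- The images under `η` of the generating morphisms. -/
def etaGen : ∀ {a b : List Colour}, AHAHGen a b → (flipObj k a ⟶ flipObj k b)
  | _, _, .dot c => Pres.hom (x c.flip)
  | _, _, .cross c => Pres.hom (s c.flip)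
  | _, _, .swap => Pres.hom τ
  | _, _, .swapInv => Pres.hom σ
  | _, _, .dumbbell => -Pres.hom (.comp τ (.comp d σ))

/-- Evaluation of expressions at the images of the generators. -/
abbrev etaEval {a b : List Colour} (f : Term k AHAHGen a b) : flipObj k a ⟶ flipObj k b :=
  Pres.eval (flipObj k) (flipObj_append k) (etaGen k) f

theorem etaEval_comp {a b c : List Colour} (f : Term k AHAHGen a b) (g : Term k AHAHGen b c) :
    etaEval k (.comp f g) = etaEval k f ≫ etaEval k g := rfl

theorem etaEval_add {a b : List Colour} (f g : Term k AHAHGen a b) :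
    etaEval k (.add f g) = etaEval k f + etaEval k g := rfl

theorem etaEval_smul {a b : List Colour} (r : k) (f : Term k AHAHGen a b) :
    etaEval k (.smul r f) = r • etaEval k f := rfl

theorem etaEval_one (a : List Colour) : etaEval k (.one a) = 𝟙 _ := rfl

theorem etaEval_x₁ (c c' : Colour) : etaEval k (x₁ c c') = Pres.hom (x₁ c.flip c'.flip) :=
  (Category.id_comp _).trans (Category.comp_id _)

theorem etaEval_x₂ (c c' : Colour) : etaEval k (x₂ c c') = Pres.hom (x₂ c.flip c'.flip) :=
  (Category.id_comp _).trans (Category.comp_id _)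

theorem etaEval_s₁ (c c' : Colour) : etaEval k (s₁ c c') = Pres.hom (s₁ c.flip c'.flip) :=
  (Category.id_comp _).trans (Category.comp_id _)

theorem etaEval_s₂ (c c' : Colour) : etaEval k (s₂ c c') = Pres.hom (s₂ c.flip c'.flip) :=
  (Category.id_comp _).trans (Category.comp_id _)

theorem etaEval_σbbr : etaEval k σbbr = Pres.hom τrrb :=
  congrArg₂ (· ≫ ·)
    ((Category.id_comp _).trans (Category.comp_id (X := (⟨[red, red, blue]⟩ : AHAH k))
      (Y := ⟨[red, blue, red]⟩) (Pres.hom (.tensor (str red) τ))))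
    ((Category.id_comp _).trans (Category.comp_id (X := (⟨[red, blue, red]⟩ : AHAH k))
      (Y := ⟨[blue, red, red]⟩) (Pres.hom (.tensor τ (str red)))))

theorem etaEval_σbrr : etaEval k σbrr = Pres.hom τrbb :=
  congrArg₂ (· ≫ ·)
    ((Category.id_comp _).trans (Category.comp_id (X := (⟨[red, blue, blue]⟩ : AHAH k))
      (Y := ⟨[blue, red, blue]⟩) (Pres.hom (.tensor τ (str blue)))))
    ((Category.id_comp _).trans (Category.comp_id (X := (⟨[blue, red, blue]⟩ : AHAH k))
      (Y := ⟨[blue, blue, red]⟩) (Pres.hom (.tensor (str blue) τ))))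

theorem of_rel {a b : List Colour} {f g : Term k AHAHGen a b} (h : AHAHRel k a b f g) :
    (Pres.hom f : (⟨a⟩ : AHAH k) ⟶ ⟨b⟩) = Pres.hom g := Pres.mk_eq (.of h)

theorem swap_swapInv : Pres.hom σ ≫ Pres.hom τ = 𝟙 (⟨[blue, red]⟩ : AHAH k) :=
  of_rel k .swap_swapInv

theorem swapInv_swap : Pres.hom τ ≫ Pres.hom σ = 𝟙 (⟨[red, blue]⟩ : AHAH k) :=
  of_rel k .swapInv_swap

theorem tensor_inv {a b : List Colour} {f : Term k AHAHGen a b} {g : Term k AHAHGen b a}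
    (h : (Pres.hom f : (⟨a⟩ : AHAH k) ⟶ ⟨b⟩) ≫ Pres.hom g = 𝟙 _) (c : List Colour) :
    (Pres.hom (.tensor f (.one c)) : (⟨a ++ c⟩ : AHAH k) ⟶ ⟨b ++ c⟩) ≫
      Pres.hom (.tensor g (.one c)) = 𝟙 _ := by
  have h' : (Pres.hom f : (⟨a⟩ : AHAH k) ⟶ ⟨b⟩) ▷ ⟨c⟩ ≫ Pres.hom g ▷ ⟨c⟩ = 𝟙 _ := by
    rw [← comp_whiskerRight, h, id_whiskerRight]
  exact h'

theorem inv_tensor {a b : List Colour} {f : Term k AHAHGen a b} {g : Term k AHAHGen b a}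
    (h : (Pres.hom f : (⟨a⟩ : AHAH k) ⟶ ⟨b⟩) ≫ Pres.hom g = 𝟙 _) (c : List Colour) :
    (Pres.hom (.tensor (.one c) f) : (⟨c ++ a⟩ : AHAH k) ⟶ ⟨c ++ b⟩) ≫
      Pres.hom (.tensor (.one c) g) = 𝟙 _ := by
  have h' : (⟨c⟩ : AHAH k) ◁ (Pres.hom f : (⟨a⟩ : AHAH k) ⟶ ⟨b⟩) ≫ ⟨c⟩ ◁ Pres.hom g = 𝟙 _ := by
    rw [← MonoidalCategory.whiskerLeft_comp, h, MonoidalCategory.whiskerLeft_id]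
  exact h'

theorem comp_inv {A B D : AHAH k} {f : A ⟶ B} {f' : B ⟶ A} {g : B ⟶ D} {g' : D ⟶ B}
    (hf : f ≫ f' = 𝟙 _) (hg : g ≫ g' = 𝟙 _) : (f ≫ g) ≫ (g' ≫ f') = 𝟙 _ := by
  rw [Category.assoc, reassoc_of% hg, hf]

theorem σbrr_τrrb : Pres.hom σbrr ≫ Pres.hom τrrb = 𝟙 (⟨[blue, red, red]⟩ : AHAH k) :=
  comp_inv k (tensor_inv k (swap_swapInv k) [red]) (inv_tensor k (swap_swapInv k) [red])

theorem τrrb_σbrr : Pres.hom τrrb ≫ Pres.hom σbrr = 𝟙 (⟨[red, red, blue]⟩ : AHAH k) :=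
  comp_inv k (inv_tensor k (swapInv_swap k) [red]) (tensor_inv k (swapInv_swap k) [red])

theorem σbbr_τrbb : Pres.hom σbbr ≫ Pres.hom τrbb = 𝟙 (⟨[blue, blue, red]⟩ : AHAH k) :=
  comp_inv k (inv_tensor k (swap_swapInv k) [blue]) (tensor_inv k (swap_swapInv k) [blue])

theorem τrbb_σbbr : Pres.hom τrbb ≫ Pres.hom σbbr = 𝟙 (⟨[red, blue, blue]⟩ : AHAH k) :=
  comp_inv k (tensor_inv k (swapInv_swap k) [blue]) (inv_tensor k (swapInv_swap k) [blue])

theorem slide_inv {A B : AHAH k} {f : A ⟶ A} {g : B ⟶ B} {u : A ⟶ B} {v : B ⟶ A}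
    (h : f ≫ u = u ≫ g) (huv : u ≫ v = 𝟙 _) (hvu : v ≫ u = 𝟙 _) : g ≫ v = v ≫ f := by
  calc g ≫ v = (v ≫ u) ≫ g ≫ v := by rw [hvu, Category.id_comp]
    _ = v ≫ (u ≫ g) ≫ v := by simp only [Category.assoc]
    _ = v ≫ (f ≫ u) ≫ v := by rw [h]
    _ = v ≫ f := by rw [Category.assoc, huv, Category.comp_id]

theorem etaEval_dotted :
    etaEval k dotted = -(Pres.hom τ ≫ Pres.hom dotted ≫ Pres.hom σ) := by
  have e₁ := of_rel k .blue_dot_swap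
  have e₂ := of_rel k .red_dot_swap
  change Pres.hom (x₁ blue red) ≫ Pres.hom σ = Pres.hom σ ≫ Pres.hom (x₂ red blue) at e₁
  change Pres.hom (x₂ blue red) ≫ Pres.hom σ = Pres.hom σ ≫ Pres.hom (x₁ red blue) at e₂
  change etaEval k (x₂ blue red) + (-1 : k) • etaEval k (x₁ blue red) =
    -(Pres.hom τ ≫ (Pres.hom (x₂ blue red) + (-1 : k) • Pres.hom (x₁ blue red)) ≫ Pres.hom σ)
  rw [etaEval_x₁, etaEval_x₂, Preadditive.add_comp, Linear.smul_comp, e₁, e₂,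
    Preadditive.comp_add, Linear.comp_smul, reassoc_of% (swapInv_swap k),
    reassoc_of% (swapInv_swap k), neg_add, neg_smul, neg_smul, one_smul, one_smul, neg_neg,
    add_comm]
  rfl

theorem etaEval_rel {a b : List Colour} {f g : Term k AHAHGen a b} (h : AHAHRel k a b f g) :
    etaEval k f = etaEval k g := by
  cases h with
  | quadratic c => exact of_rel k (.quadratic c.flip)
  | braid c =>
    rw [etaEval_comp, etaEval_comp, etaEval_comp, etaEval_comp, etaEval_s₁, etaEval_s₂]
    exact of_rel k (.braid c.flip)
  | dot_cross c =>
    rw [etaEval_add, etaEval_comp, etaEval_comp, etaEval_x₁, etaEval_x₂]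
    exact of_rel k (.dot_cross c.flip)
  | cross_dot c =>
    rw [etaEval_add, etaEval_comp, etaEval_comp, etaEval_x₁, etaEval_x₂]
    exact of_rel k (.cross_dot c.flip)
  | swap_swapInv => exact swapInv_swap k
  | swapInv_swap => exact swap_swapInv k
  | blue_dot_swap =>
    rw [etaEval_comp, etaEval_comp, etaEval_x₁, etaEval_x₂]
    exact slide_inv k (of_rel k .red_dot_swap) (swap_swapInv k) (swapInv_swap k)
  | red_dot_swap =>
    rw [etaEval_comp, etaEval_comp, etaEval_x₁, etaEval_x₂]
    exact slide_inv k (of_rel k .blue_dot_swap) (swap_swapInv k) (swapInv_swap k)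
  | blue_cross_swap =>
    rw [etaEval_comp k (s₁ blue red), etaEval_comp k σbbr (s₂ red blue), etaEval_s₁, etaEval_s₂,
      etaEval_σbbr]
    exact slide_inv k (of_rel k .red_cross_swap) (σbrr_τrrb k) (τrrb_σbrr k)
  | red_cross_swap =>
    rw [etaEval_comp k (s₂ blue red), etaEval_comp k σbrr (s₁ red blue), etaEval_s₁, etaEval_s₂,
      etaEval_σbrr]
    exact slide_inv k (of_rel k .blue_cross_swap) (σbbr_τrbb k) (τrbb_σbbr k)
  | dotted_dumbbell =>
    rw [etaEval_comp, etaEval_dotted]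
    have h : Pres.hom dotted ≫ Pres.hom d = 𝟙 (⟨[blue, red]⟩ : AHAH k) :=
      of_rel k .dotted_dumbbell
    change (-(Pres.hom τ ≫ Pres.hom dotted ≫ Pres.hom σ)) ≫
      (-(Pres.hom τ ≫ Pres.hom d ≫ Pres.hom σ)) = 𝟙 (⟨[red, blue]⟩ : AHAH k)
    simp only [Preadditive.neg_comp, Preadditive.comp_neg, neg_neg, Category.assoc]
    rw [reassoc_of% (swap_swapInv k), reassoc_of% h, swapInv_swap]
  | dumbbell_dotted =>
    rw [etaEval_comp, etaEval_dotted]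
    have h : Pres.hom d ≫ Pres.hom dotted = 𝟙 (⟨[blue, red]⟩ : AHAH k) :=
      of_rel k .dumbbell_dotted
    change (-(Pres.hom τ ≫ Pres.hom d ≫ Pres.hom σ)) ≫
      (-(Pres.hom τ ≫ Pres.hom dotted ≫ Pres.hom σ)) = 𝟙 (⟨[red, blue]⟩ : AHAH k)
    simp only [Preadditive.neg_comp, Preadditive.comp_neg, neg_neg, Category.assoc]
    rw [reassoc_of% (swap_swapInv k), reassoc_of% h, swapInv_swap]

/-- The involution `η`: the strict `k`-linear monoidal functor which switches the colours and
multiplies by `-1` for each dumbbell. -/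
def eta : AHAH k ⥤ AHAH k :=
  Pres.lift (flipObj k) rfl (flipObj_append k) (etaGen k) (etaEval_rel k)

instance : (eta k).Additive := by unfold eta; infer_instance

instance : (eta k).Linear k := by unfold eta; infer_instance

theorem eta_isStrictMonoidal : IsStrictMonoidal (eta k) := Pres.lift_isStrictMonoidal _ _ _ _ _

end AHAH

/-! ### The images of the generators under the categorical comultiplication -/

section Comultiplication

variable (k : Type u) [CommRing k]

open AHAH

/-- The colours of the two summands of `blue ↑ ⊕ red ↑`. -/
def col : Fin 2 → Colour := ![blue, red]

/-- The object `blue ↑ ⊕ red ↑` of the additive envelope. -/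
abbrev blueRed : AddEnv (AHAH k) := ⟨2, fun i => up k (col i)⟩

/-- The matrix entries of the sum of the blue dot and the red dot. -/
def comulDotEntry : ∀ c e : Colour, up k c ⟶ up k e
  | blue, blue => dot k blue
  | red, red => dot k red
  | _, _ => 0

/-- The image of the dot: the sum of the blue dot and the red dot. -/
def comulDot : blueRed k ⟶ blueRed k :=
  AddEnv.ofMatrix fun i j => comulDotEntry k (col i) (col j)

/-- The matrix entries of the image of the crossing, `c ⊗ c'` being the bottom and `e ⊗ e'` the
top of the diagrams. -/
def comulCrossingEntry : ∀ c c' e e' : Colour, up k c ⊗ up k c' ⟶ up k e ⊗ up k e'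
  | blue, blue, blue, blue => crossing k blue blue
  | red, red, red, red => crossing k red red
  | blue, red, red, blue => crossing k blue red - dumbbellBR k ≫ crossing k blue red
  | red, blue, blue, red => crossing k red blue + dumbbellRB k ≫ crossing k red blue
  | blue, red, blue, red => -dumbbellBR k
  | red, blue, red, blue => dumbbellRB k
  | _, _, _, _ => 0

/-- The image of the crossing, an endomorphism of
`blue ⊗ blue ⊕ blue ⊗ red ⊕ red ⊗ blue ⊕ red ⊗ red`. -/
def comulCrossing : blueRed k ⊗ blueRed k ⟶ blueRed k ⊗ blueRed k :=
  AddEnv.ofMatrix (A := AddEnv.tensorObj' (blueRed k) (blueRed k))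
    (B := AddEnv.tensorObj' (blueRed k) (blueRed k)) fun p q =>
    comulCrossingEntry k (col p.divNat) (col p.modNat) (col q.divNat) (col q.modNat)

/-- The matrix entries of the isomorphism `red ⊕ blue ⟶ blue ⊕ red` reordering the summands. -/
def reorderEntry : ∀ c e : Colour, up k c.flip ⟶ up k e
  | blue, red => 𝟙 (up k red)
  | red, blue => 𝟙 (up k blue)
  | _, _ => 0

/-- The canonical isomorphism `η(blue ⊕ red) = red ⊕ blue ⟶ blue ⊕ red` reordering the two
summands. -/
def reorder : (AddEnv.map (eta k)).obj (blueRed k) ⟶ blueRed k :=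
  AddEnv.ofMatrix (A := (AddEnv.map (eta k)).obj (blueRed k)) (B := blueRed k) fun i j =>
    reorderEntry k (col i) (col j)

end Comultiplication

end Heis

end

open Heis

set_option linter.unusedSimpArgs false

noncomputable section

namespace Heis

/-! ### Strict monoidal functors out of the degenerate affine Hecke category -/

/-! A strict `k`-linear monoidal functor out of `AH k` amounts to an object `V` of the target with a
dot on `V` and a crossing on `V ⊗ V` satisfying four relations (`IsAffineHecke`). So the existence
of Δ is the statement that `comulDot` and `comulCrossing` satisfy these relations as matrices over
the localized symmetric product.

Write `d` for the inverse of "right dot minus left dot" on two strings of different colours. With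
this sign, uniform in the colours, the mixed part of the crossing is `-d + (1 - d)σ` for both orders
of the colours, and passing `d` through σ changes its sign. Since `d` commutes with dots, the term
`(1 - d)σ` lets dots slide freely, while `-d` contributes exactly the correction 1 of the dot
relations. The quadratic relation becomes `d² + (1 - d)(1 + d) = 1`.

The braid relation is the substantial one. All entries preserve the number of strings of each
colour, so it splits into the one-colour relations and the case of two strings of colour `c` and one
of colour `c'`. There the three words ccc', cc'c, c'cc are isomorphic through two-colour crossings,
and every entry can be transported to an endomorphism of ccc'. These endomorphisms are polynomials
in the crossing `s` of the two equal strings and in the dumbbells `e = (x₃ - x₂)⁻¹` and `f = (x₃ -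
x₁)⁻¹`. The crossing exchanges `e` and `f` up to the term `ef` (`mixedStrings`), and this gives a
normal form in which each of the nine matrix identities is a computation (`MixedStrings`,
`colourMul_braid`).

For the symmetry, a monoidal transformation is determined by its component at ↑, and its naturality
need only be tested on the dot and the crossing (`powApp_naturality`). For the interchange of the
two summands this says that η carries each matrix entry to the entry with flipped colours
(`eta_comulCrossingEntry`); the sign of η on dumbbells is what makes this hold. Tensor products of
permutations of summands are again such permutations, hence so is every component. -/

section Powers

variable {D : Type v} [Category.{u} D] [MonoidalCategory D]

/-- The tensor power of an object indexed by the letters of a word. -/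
def tensorPow (V : D) : List Unit → D
  | [] => 𝟙_ D
  | _ :: l => V ⊗ tensorPow V l

variable [StrictMonoidalCategory D]

theorem tensorPow_append (V : D) :
    ∀ a b : List Unit, tensorPow V (a ++ b) = tensorPow V a ⊗ tensorPow V b
  | [], b => (StrictMonoidalCategory.unit_tensor (tensorPow V b)).symm
  | _ :: a, b => (congrArg (V ⊗ ·) (tensorPow_append V a b)).trans
      (StrictMonoidalCategory.tensor_assoc _ _ _).symm

/-- The recursion ends in the unit object, so even the one-letter power is `V ⊗ 𝟙_ D`, which is
equal to `V` only through strictness. This is the source of the `eqToHom` conjugations below. -/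
theorem tensorPow_one (V : D) : tensorPow V [()] = V := StrictMonoidalCategory.tensor_unit V

theorem tensorPow_two (V : D) : tensorPow V [(), ()] = V ⊗ V :=
  congrArg (V ⊗ ·) (tensorPow_one V)

theorem tensorPow_three (V : D) : tensorPow V [(), (), ()] = (V ⊗ V) ⊗ V :=
  (congrArg (V ⊗ ·) (tensorPow_two V)).trans (StrictMonoidalCategory.tensor_assoc _ _ _).symm

/-- Brings an identity into the conjugated shape from which `conj_tensorHom` and `tensorHom_conj`
pull transports out of a tensor product. -/
theorem id_eq_conj {X Y : D} (h : X = Y) : 𝟙 X = eqToHom h ≫ 𝟙 Y ≫ eqToHom h.symm := by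
  subst h; simp

end Powers

/-- An object of a strict monoidal category with a dot and a crossing satisfying the relations of
the degenerate affine Hecke category. -/
structure IsAffineHecke {D : Type v} [Category.{u} D] [Preadditive D] [MonoidalCategory D]
    {V : D} (x : V ⟶ V) (s : V ⊗ V ⟶ V ⊗ V) : Prop where
  quadratic : s ≫ s = 𝟙 _
  braid : s ▷ V ≫ ((α_ V V V).hom ≫ V ◁ s ≫ (α_ V V V).inv) ≫ s ▷ V =
    ((α_ V V V).hom ≫ V ◁ s ≫ (α_ V V V).inv) ≫ s ▷ V ≫
      ((α_ V V V).hom ≫ V ◁ s ≫ (α_ V V V).inv)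
  dot_cross : x ▷ V ≫ s = s ≫ V ◁ x + 𝟙 _
  cross_dot : s ≫ x ▷ V = V ◁ x ≫ s + 𝟙 _

section Lift

variable {k : Type u} [CommRing k] {D : Type v} [Category.{u} D] [Preadditive D] [Linear k D]
  [MonoidalCategory D] [StrictMonoidalCategory D]

/-- The images of the generating morphisms determined by a dot and a crossing. -/
def affineHeckeGen {V : D} (x : V ⟶ V) (s : V ⊗ V ⟶ V ⊗ V) :
    ∀ {a b : List Unit}, AHGen a b → (tensorPow V a ⟶ tensorPow V b)
  | _, _, .dot => eqToHom (tensorPow_one V) ≫ x ≫ eqToHom (tensorPow_one V).symm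
  | _, _, .cross => eqToHom (tensorPow_two V) ≫ s ≫ eqToHom (tensorPow_two V).symm

/-- Evaluation of expressions at a dot and a crossing. -/
abbrev affineHeckeEval {V : D} (x : V ⟶ V) (s : V ⊗ V ⟶ V ⊗ V) {a b : List Unit}
    (f : Term k AHGen a b) : tensorPow V a ⟶ tensorPow V b :=
  Pres.eval (tensorPow V) (tensorPow_append V) (affineHeckeGen x s) f

variable {V : D} (x : V ⟶ V) (s : V ⊗ V ⟶ V ⊗ V)

theorem affineHeckeEval_cross : affineHeckeEval (k := k) x s AH.s =
    eqToHom (tensorPow_two V) ≫ s ≫ eqToHom (tensorPow_two V).symm := rfl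

theorem affineHeckeEval_one (a : List Unit) :
    affineHeckeEval (k := k) x s (.one a) = 𝟙 _ := rfl

theorem affineHeckeEval_comp {a b c : List Unit} (f : Term k AHGen a b) (g : Term k AHGen b c) :
    affineHeckeEval x s (.comp f g) = affineHeckeEval x s f ≫ affineHeckeEval x s g := rfl

theorem affineHeckeEval_add {a b : List Unit} (f g : Term k AHGen a b) :
    affineHeckeEval x s (.add f g) = affineHeckeEval x s f + affineHeckeEval x s g := rfl

theorem affineHeckeEval_x₁ : affineHeckeEval (k := k) x s AH.x₁ =
    eqToHom (tensorPow_two V) ≫ x ▷ V ≫ eqToHom (tensorPow_two V).symm := by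
  change eqToHom _ ≫ ((eqToHom _ ≫ x ≫ eqToHom _) ⊗ₘ 𝟙 (tensorPow V [()])) ≫ eqToHom _ = _
  rw [id_eq_conj (tensorPow_one V), conj_tensorHom, tensorHom_conj, tensorHom_id]
  simp only [Category.assoc, eqToHom_trans, eqToHom_trans_assoc]

theorem affineHeckeEval_x₂ : affineHeckeEval (k := k) x s AH.x₂ =
    eqToHom (tensorPow_two V) ≫ V ◁ x ≫ eqToHom (tensorPow_two V).symm := by
  change eqToHom _ ≫ (𝟙 (tensorPow V [()]) ⊗ₘ (eqToHom _ ≫ x ≫ eqToHom _)) ≫ eqToHom _ = _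
  rw [id_eq_conj (tensorPow_one V), conj_tensorHom, tensorHom_conj, id_tensorHom]
  simp only [Category.assoc, eqToHom_trans, eqToHom_trans_assoc]

theorem affineHeckeEval_s₁ : affineHeckeEval (k := k) x s AH.s₁ =
    eqToHom (tensorPow_three V) ≫ s ▷ V ≫ eqToHom (tensorPow_three V).symm := by
  change eqToHom _ ≫ ((eqToHom _ ≫ s ≫ eqToHom _) ⊗ₘ 𝟙 (tensorPow V [()])) ≫ eqToHom _ = _
  rw [id_eq_conj (tensorPow_one V), conj_tensorHom, tensorHom_conj, tensorHom_id]
  simp only [Category.assoc, eqToHom_trans, eqToHom_trans_assoc]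

/-- The power on three letters is compared with `(V ⊗ V) ⊗ V`, whereas the right crossing lives on
`V ⊗ (V ⊗ V)`. In a strict category the associators are themselves transports and merge with the
others. -/
theorem affineHeckeEval_s₂ : affineHeckeEval (k := k) x s AH.s₂ =
    eqToHom (tensorPow_three V) ≫ ((α_ V V V).hom ≫ V ◁ s ≫ (α_ V V V).inv) ≫
      eqToHom (tensorPow_three V).symm := by
  have h : (α_ V V V).inv = eqToHom (StrictMonoidalCategory.tensor_assoc V V V).symm := by
    rw [← cancel_epi (α_ V V V).hom, StrictMonoidalCategory.associator_hom,
      ← StrictMonoidalCategory.associator_hom, Iso.hom_inv_id,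
      StrictMonoidalCategory.associator_hom, eqToHom_trans, eqToHom_refl]
  change eqToHom _ ≫ (𝟙 (tensorPow V [()]) ⊗ₘ (eqToHom _ ≫ s ≫ eqToHom _)) ≫ eqToHom _ = _
  rw [id_eq_conj (tensorPow_one V), conj_tensorHom, tensorHom_conj, id_tensorHom, h,
    StrictMonoidalCategory.associator_hom]
  simp only [Category.assoc, eqToHom_trans, eqToHom_trans_assoc]

variable {x s}

/-- All diagrams on a given number of strings are conjugated by the same transport, so adjacent
transports cancel and the bare relation remains. -/
theorem IsAffineHecke.eval_rel (h : IsAffineHecke x s) {a b : List Unit}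
    {f g : Term k AHGen a b} (hR : AHRel k a b f g) :
    affineHeckeEval x s f = affineHeckeEval x s g := by
  cases hR with
  | quadratic =>
    rw [affineHeckeEval_comp, affineHeckeEval_cross, affineHeckeEval_one]
    simp [reassoc_of% h.quadratic]
  | braid =>
    simp only [affineHeckeEval_comp, affineHeckeEval_s₁, affineHeckeEval_s₂]
    simp only [Category.assoc, eqToHom_trans_assoc, eqToHom_refl, Category.id_comp]
    have := h.braid
    simp only [Category.assoc] at this
    rw [reassoc_of% this]
  | dot_cross =>
    rw [affineHeckeEval_add, affineHeckeEval_comp, affineHeckeEval_comp, affineHeckeEval_cross,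
      affineHeckeEval_one, affineHeckeEval_x₁, affineHeckeEval_x₂]
    simp [reassoc_of% h.dot_cross]
  | cross_dot =>
    rw [affineHeckeEval_add, affineHeckeEval_comp, affineHeckeEval_comp, affineHeckeEval_cross,
      affineHeckeEval_one, affineHeckeEval_x₁, affineHeckeEval_x₂]
    simp [reassoc_of% h.cross_dot]

end Lift

/-! ### Monoidal natural transformations out of the degenerate affine Hecke category -/

section NatTrans

variable {k : Type u} [CommRing k] {D : Type v} [Category.{u} D] [MonoidalCategory D]
  {F F' : AH k ⥤ D} (hF : IsStrictMonoidal F) (hF' : IsStrictMonoidal F')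
  (t : F.obj (AH.up k) ⟶ F'.obj (AH.up k))

/-- The components of the monoidal transformation with a given component at the generating
object. -/
def powApp : ∀ a : List Unit, F.obj ⟨a⟩ ⟶ F'.obj ⟨a⟩
  | [] => eqToHom (hF.obj_unit.trans hF'.obj_unit.symm)
  | _ :: l => eqToHom (hF.obj_tensor (AH.up k) ⟨l⟩) ≫ (t ⊗ₘ powApp l) ≫
      eqToHom (hF'.obj_tensor (AH.up k) ⟨l⟩).symm

theorem powApp_cons (l : List Unit) : powApp hF hF' t (() :: l) =
    eqToHom (hF.obj_tensor (AH.up k) ⟨l⟩) ≫ (t ⊗ₘ powApp hF hF' t l) ≫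
      eqToHom (hF'.obj_tensor (AH.up k) ⟨l⟩).symm := rfl

variable [StrictMonoidalCategory D]

/-- By induction on the first word, using strict associativity. This is precisely monoidality of the
transformation with components `powApp`. -/
theorem powApp_append : ∀ a b : List Unit, powApp hF hF' t (a ++ b) =
    eqToHom (hF.obj_tensor ⟨a⟩ ⟨b⟩) ≫ (powApp hF hF' t a ⊗ₘ powApp hF hF' t b) ≫
      eqToHom (hF'.obj_tensor ⟨a⟩ ⟨b⟩).symm
  | [], b => by
    have e : powApp hF hF' t [] = eqToHom hF.obj_unit ≫ 𝟙 (𝟙_ D) ≫ eqToHom hF'.obj_unit.symm := by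
      simp [powApp]
    rw [e, conj_tensorHom, strict_unit_left]
    simp only [Category.assoc, eqToHom_trans, eqToHom_trans_assoc]
    -- The remaining transports have definitionally equal ends, because `[] ++ b` reduces to `b`.
    exact ((Category.id_comp _).trans (Category.comp_id _)).symm
  | _ :: a, b => by
    refine (powApp_cons hF hF' t (a ++ b)).trans ?_
    rw [powApp_append a b, powApp_cons, conj_tensorHom, tensorHom_conj, strict_assoc]
    simp only [Category.assoc, eqToHom_trans, eqToHom_trans_assoc]

variable [Preadditive D] [Linear k D] [F.Additive] [F.Linear k] [F'.Additive] [F'.Linear k]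

/-- The morphisms with commuting naturality square are closed under composition, tensor product and
linear combination, so it is enough to test the two generating morphisms. -/
theorem powApp_naturality
    (hdot : F.map (AH.dot k) ≫ powApp hF hF' t [()] = powApp hF hF' t [()] ≫ F'.map (AH.dot k))
    (hcross : F.map (AH.crossing k) ≫ powApp hF hF' t [(), ()] =
      powApp hF hF' t [(), ()] ≫ F'.map (AH.crossing k)) {a b : List Unit}
    (f : Term k AHGen a b) :
    F.map (Pres.hom f : (⟨a⟩ : AH k) ⟶ ⟨b⟩) ≫ powApp hF hF' t b =
      powApp hF hF' t a ≫ F'.map (Pres.hom f : (⟨a⟩ : AH k) ⟶ ⟨b⟩) := by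
  induction f with
  | gen g =>
    cases g with
    | dot => exact hdot
    | cross => exact hcross
  | str h =>
    subst h
    exact (congrArg (· ≫ _) (F.map_id _)).trans ((Category.id_comp _).trans
      ((Category.comp_id _).symm.trans (congrArg (_ ≫ ·) (F'.map_id _).symm)))
  | comp f g ihf ihg =>
    change F.map (Pres.hom f ≫ Pres.hom g) ≫ _ = _ ≫ F'.map (Pres.hom f ≫ Pres.hom g)
    rw [Functor.map_comp, Functor.map_comp, Category.assoc, ihg, reassoc_of% ihf]
  | tensor f g ihf ihg =>
    change F.map (Pres.hom f ⊗ₘ Pres.hom g) ≫ _ = _ ≫ F'.map (Pres.hom f ⊗ₘ Pres.hom g)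
    rw [hF.map_tensor, hF'.map_tensor, powApp_append, powApp_append]
    simp only [Category.assoc, eqToHom_trans_assoc, eqToHom_refl, Category.id_comp,
      tensorHom_comp_tensorHom_assoc]
    rw [ihf, ihg]
  | zero =>
    change F.map 0 ≫ _ = _ ≫ F'.map 0
    rw [Functor.map_zero, Functor.map_zero]; simp
  | add f g ihf ihg =>
    change F.map (Pres.hom f + Pres.hom g) ≫ _ = _ ≫ F'.map (Pres.hom f + Pres.hom g)
    rw [Functor.map_add, Functor.map_add, Preadditive.add_comp, Preadditive.comp_add, ihf, ihg]
  | smul r f ih =>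
    change F.map (r • Pres.hom f) ≫ _ = _ ≫ F'.map (r • Pres.hom f)
    rw [Functor.map_smul, Functor.map_smul, Linear.smul_comp, Linear.comp_smul, ih]

end NatTrans

/-! ### The braid relation for mixed strings, as an identity of matrices -/

section MixedBraid

variable {C : Type v} [Category.{u} C] [Preadditive C] {P Q R : C}
  {p : P ⟶ Q} {p' : Q ⟶ P} {q : Q ⟶ R} {q' : R ⟶ Q} {s e f y z : P ⟶ P}

/-- Three strings, two of one colour and one of the other: `P`, `Q`, `R` are the three words, `p`
and `q` move the string of the other colour to the left, `s` is the crossing of the two strings of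
the same colour, and `e`, `f` are the two dumbbells. -/
structure MixedStrings (p : P ⟶ Q) (p' : Q ⟶ P) (q : Q ⟶ R) (q' : R ⟶ Q)
    (s e f : P ⟶ P) : Prop where
  pp' : p ≫ p' = 𝟙 P
  qq' : q ≫ q' = 𝟙 Q
  ss : s ≫ s = 𝟙 P
  ef : f ≫ e = e ≫ f
  se : s ≫ e = f ≫ s - e ≫ f
  sf : s ≫ f = e ≫ s + e ≫ f

/-- Commutation of the crossing with the inverses `e` of `y` and `f` of `z`. -/
theorem MixedStrings.of_inverse (pp' : p ≫ p' = 𝟙 P) (qq' : q ≫ q' = 𝟙 Q) (ss : s ≫ s = 𝟙 P)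
    (ye : y ≫ e = 𝟙 P) (ey : e ≫ y = 𝟙 P) (zf : z ≫ f = 𝟙 P) (fz : f ≫ z = 𝟙 P)
    (yz : y ≫ z = z ≫ y) (ys : y ≫ s = s ≫ z + 𝟙 P) (zs : z ≫ s = s ≫ y - 𝟙 P) :
    MixedStrings p p' q q' s e f := by
  -- Inverses of commuting elements commute: first `f` with `y`, then `f` with `e`.
  have hf : f ≫ y = y ≫ f := by
    calc f ≫ y = f ≫ (y ≫ z) ≫ f := by simp [zf]
      _ = y ≫ f := by rw [yz, Category.assoc, reassoc_of% fz]
  have hfe : f ≫ e = e ≫ f := by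
    calc f ≫ e = e ≫ (y ≫ f) ≫ e := by simp [reassoc_of% ey]
      _ = e ≫ f := by rw [← hf, Category.assoc, ye, Category.comp_id]
  exact {
  pp' := pp'
  qq' := qq'
  ss := ss
  ef := hfe
  se := by
    -- Insert `f ≫ z = 𝟙`, move `z` past `s`, and cancel the resulting `y` against `e`. The
    -- correction `∓𝟙` in the relation for `z` leaves the term `e ≫ f`.
    calc s ≫ e = f ≫ (z ≫ s) ≫ e := by rw [Category.assoc, reassoc_of% fz]
      _ = f ≫ s - e ≫ f := by simp [zs, ye, hfe]
  sf := by
    calc s ≫ f = e ≫ (y ≫ s) ≫ f := by rw [Category.assoc, reassoc_of% ey]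
      _ = e ≫ s + e ≫ f := by simp [ys, zf] }

namespace MixedStrings

variable (h : MixedStrings p p' q q' s e f)
include h

/-- The nine lemmas `braid_PP`, …, `braid_RR` are the entries of the braid relation, labelled by
source and target word, with all factors transported to `P`. The left crossing fixes `P` and mixes
`Q`, `R`; the right one mixes `P`, `Q` and fixes `R`. In each proof `p ≫ p'` and `q ≫ q'` cancel,
and the relations of `MixedStrings` move `s` to the right of all dumbbells, sort `e` before `f` and
remove squares of `s`. Both sides then agree up to the order of summands. -/
theorem braid_PP : s ≫ (-e) ≫ s = (-e) ≫ s ≫ (-e) + ((𝟙 P - e) ≫ p) ≫ (-(p' ≫ f ≫ p)) ≫ (p' ≫ (𝟙 P + e)) := by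
  simp only [Preadditive.add_comp, Preadditive.comp_add, Preadditive.sub_comp,
    Preadditive.comp_sub, Preadditive.neg_comp, Preadditive.comp_neg, Category.assoc,
    Category.id_comp, Category.comp_id, h.ss, h.se, h.sf, h.ef, h.pp', h.qq', reassoc_of% h.ss,
    reassoc_of% h.se, reassoc_of% h.sf, reassoc_of% h.ef, reassoc_of% h.pp', reassoc_of% h.qq']
  abel

theorem braid_PQ : s ≫ ((𝟙 P - e) ≫ p) ≫ (-(p' ≫ f ≫ p)) =
    (-e) ≫ s ≫ ((𝟙 P - e) ≫ p) + ((𝟙 P - e) ≫ p) ≫ (-(p' ≫ f ≫ p)) ≫ (p' ≫ e ≫ p) := by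
  simp only [Preadditive.add_comp, Preadditive.comp_add, Preadditive.sub_comp,
    Preadditive.comp_sub, Preadditive.neg_comp, Preadditive.comp_neg, Category.assoc,
    Category.id_comp, Category.comp_id, h.ss, h.se, h.sf, h.ef, h.pp', h.qq', reassoc_of% h.ss,
    reassoc_of% h.se, reassoc_of% h.sf, reassoc_of% h.ef, reassoc_of% h.pp', reassoc_of% h.qq']
  abel

theorem braid_PR : s ≫ ((𝟙 P - e) ≫ p) ≫ (p' ≫ (𝟙 P - f) ≫ p ≫ q) =
    ((𝟙 P - e) ≫ p) ≫ (p' ≫ (𝟙 P - f) ≫ p ≫ q) ≫ (q' ≫ p' ≫ s ≫ p ≫ q) := by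
  simp only [Preadditive.add_comp, Preadditive.comp_add, Preadditive.sub_comp,
    Preadditive.comp_sub, Preadditive.neg_comp, Preadditive.comp_neg, Category.assoc,
    Category.id_comp, Category.comp_id, h.ss, h.se, h.sf, h.ef, h.pp', h.qq', reassoc_of% h.ss,
    reassoc_of% h.se, reassoc_of% h.sf, reassoc_of% h.ef, reassoc_of% h.pp', reassoc_of% h.qq']
  abel

theorem braid_QP : (-(p' ≫ f ≫ p)) ≫ (p' ≫ (𝟙 P + e)) ≫ s =
    (p' ≫ (𝟙 P + e)) ≫ s ≫ (-e) + (p' ≫ e ≫ p) ≫ (-(p' ≫ f ≫ p)) ≫ (p' ≫ (𝟙 P + e)) := by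
  simp only [Preadditive.add_comp, Preadditive.comp_add, Preadditive.sub_comp,
    Preadditive.comp_sub, Preadditive.neg_comp, Preadditive.comp_neg, Category.assoc,
    Category.id_comp, Category.comp_id, h.ss, h.se, h.sf, h.ef, h.pp', h.qq', reassoc_of% h.ss,
    reassoc_of% h.se, reassoc_of% h.sf, reassoc_of% h.ef, reassoc_of% h.pp', reassoc_of% h.qq']
  abel

/-- The only entry with two paths on each side: left crossings lead from `Q` through `Q` or `R`,
right crossings through `P` or `Q`. -/
theorem braid_QQ : (-(p' ≫ f ≫ p)) ≫ (p' ≫ e ≫ p) ≫ (-(p' ≫ f ≫ p)) +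
      (p' ≫ (𝟙 P - f) ≫ p ≫ q) ≫ (q' ≫ p' ≫ s ≫ p ≫ q) ≫ (q' ≫ p' ≫ (𝟙 P + f) ≫ p) =
    (p' ≫ (𝟙 P + e)) ≫ s ≫ ((𝟙 P - e) ≫ p) +
      (p' ≫ e ≫ p) ≫ (-(p' ≫ f ≫ p)) ≫ (p' ≫ e ≫ p) := by
  simp only [Preadditive.add_comp, Preadditive.comp_add, Preadditive.sub_comp,
    Preadditive.comp_sub, Preadditive.neg_comp, Preadditive.comp_neg, Category.assoc,
    Category.id_comp, Category.comp_id, h.ss, h.se, h.sf, h.ef, h.pp', h.qq', reassoc_of% h.ss,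
    reassoc_of% h.se, reassoc_of% h.sf, reassoc_of% h.ef, reassoc_of% h.pp', reassoc_of% h.qq']
  abel

theorem braid_QR : (-(p' ≫ f ≫ p)) ≫ (p' ≫ e ≫ p) ≫ (p' ≫ (𝟙 P - f) ≫ p ≫ q) +
      (p' ≫ (𝟙 P - f) ≫ p ≫ q) ≫ (q' ≫ p' ≫ s ≫ p ≫ q) ≫ (q' ≫ p' ≫ f ≫ p ≫ q) =
    (p' ≫ e ≫ p) ≫ (p' ≫ (𝟙 P - f) ≫ p ≫ q) ≫ (q' ≫ p' ≫ s ≫ p ≫ q) := by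
  simp only [Preadditive.add_comp, Preadditive.comp_add, Preadditive.sub_comp,
    Preadditive.comp_sub, Preadditive.neg_comp, Preadditive.comp_neg, Category.assoc,
    Category.id_comp, Category.comp_id, h.ss, h.se, h.sf, h.ef, h.pp', h.qq', reassoc_of% h.ss,
    reassoc_of% h.se, reassoc_of% h.sf, reassoc_of% h.ef, reassoc_of% h.pp', reassoc_of% h.qq']
  abel

theorem braid_RP : (q' ≫ p' ≫ (𝟙 P + f) ≫ p) ≫ (p' ≫ (𝟙 P + e)) ≫ s =
    (q' ≫ p' ≫ s ≫ p ≫ q) ≫ (q' ≫ p' ≫ (𝟙 P + f) ≫ p) ≫ (p' ≫ (𝟙 P + e)) := by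
  simp only [Preadditive.add_comp, Preadditive.comp_add, Preadditive.sub_comp,
    Preadditive.comp_sub, Preadditive.neg_comp, Preadditive.comp_neg, Category.assoc,
    Category.id_comp, Category.comp_id, h.ss, h.se, h.sf, h.ef, h.pp', h.qq', reassoc_of% h.ss,
    reassoc_of% h.se, reassoc_of% h.sf, reassoc_of% h.ef, reassoc_of% h.pp', reassoc_of% h.qq']
  abel

theorem braid_RQ : (q' ≫ p' ≫ (𝟙 P + f) ≫ p) ≫ (p' ≫ e ≫ p) ≫ (-(p' ≫ f ≫ p)) +
      (q' ≫ p' ≫ f ≫ p ≫ q) ≫ (q' ≫ p' ≫ s ≫ p ≫ q) ≫ (q' ≫ p' ≫ (𝟙 P + f) ≫ p) =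
    (q' ≫ p' ≫ s ≫ p ≫ q) ≫ (q' ≫ p' ≫ (𝟙 P + f) ≫ p) ≫ (p' ≫ e ≫ p) := by
  simp only [Preadditive.add_comp, Preadditive.comp_add, Preadditive.sub_comp,
    Preadditive.comp_sub, Preadditive.neg_comp, Preadditive.comp_neg, Category.assoc,
    Category.id_comp, Category.comp_id, h.ss, h.se, h.sf, h.ef, h.pp', h.qq', reassoc_of% h.ss,
    reassoc_of% h.se, reassoc_of% h.sf, reassoc_of% h.ef, reassoc_of% h.pp', reassoc_of% h.qq']
  abel

theorem braid_RR : (q' ≫ p' ≫ (𝟙 P + f) ≫ p) ≫ (p' ≫ e ≫ p) ≫ (p' ≫ (𝟙 P - f) ≫ p ≫ q) +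
      (q' ≫ p' ≫ f ≫ p ≫ q) ≫ (q' ≫ p' ≫ s ≫ p ≫ q) ≫ (q' ≫ p' ≫ f ≫ p ≫ q) =
    (q' ≫ p' ≫ s ≫ p ≫ q) ≫ (q' ≫ p' ≫ f ≫ p ≫ q) ≫ (q' ≫ p' ≫ s ≫ p ≫ q) := by
  simp only [Preadditive.add_comp, Preadditive.comp_add, Preadditive.sub_comp,
    Preadditive.comp_sub, Preadditive.neg_comp, Preadditive.comp_neg, Category.assoc,
    Category.id_comp, Category.comp_id, h.ss, h.se, h.sf, h.ef, h.pp', h.qq', reassoc_of% h.ss,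
    reassoc_of% h.se, reassoc_of% h.sf, reassoc_of% h.ef, reassoc_of% h.pp', reassoc_of% h.qq']
  abel

end MixedStrings

end MixedBraid

/-! ### Two and three strings in the localized symmetric product -/

namespace AHAH

variable (k : Type u) [CommRing k]

open Colour

/-- The inverse of the right dot minus the left dot on two strings of different colours. -/
def dumbbell : ∀ c c' : Colour, up k c ⊗ up k c' ⟶ up k c ⊗ up k c'
  | blue, red => dumbbellBR k
  | red, blue => -dumbbellRB k
  | _, _ => 0

/-- The right dot minus the left dot on two strings. -/
def dotDiff (c c' : Colour) : up k c ⊗ up k c' ⟶ up k c ⊗ up k c' :=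
  up k c ◁ dot k c' - dot k c ▷ up k c'

theorem crossing_crossing (c c' : Colour) : crossing k c c' ≫ crossing k c' c = 𝟙 _ := by
  cases c <;> cases c'
  · exact of_rel k (.quadratic blue)
  · exact swap_swapInv k
  · exact swapInv_swap k
  · exact of_rel k (.quadratic red)

theorem dot_crossing_same (c : Colour) :
    dot k c ▷ up k c ≫ crossing k c c = crossing k c c ≫ up k c ◁ dot k c + 𝟙 _ := by
  cases c
  · exact of_rel k (.dot_cross blue)
  · exact of_rel k (.dot_cross red)

theorem crossing_dot_same (c : Colour) :
    crossing k c c ≫ dot k c ▷ up k c = up k c ◁ dot k c ≫ crossing k c c + 𝟙 _ := by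
  cases c
  · exact of_rel k (.cross_dot blue)
  · exact of_rel k (.cross_dot red)

variable {k} {c c' : Colour}

/-- A defining relation when blue is on the left; otherwise the relation for the other dot,
conjugated by the mutually inverse crossings. -/
theorem left_dot_crossing (h : c ≠ c') :
    dot k c ▷ up k c' ≫ crossing k c c' = crossing k c c' ≫ up k c' ◁ dot k c := by
  cases c <;> cases c'
  · exact absurd rfl h
  · exact of_rel k .blue_dot_swap
  · exact slide_inv k (of_rel k .red_dot_swap) (swap_swapInv k) (swapInv_swap k)
  · exact absurd rfl h

theorem right_dot_crossing (h : c ≠ c') :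
    up k c ◁ dot k c' ≫ crossing k c c' = crossing k c c' ≫ dot k c' ▷ up k c := by
  cases c <;> cases c'
  · exact absurd rfl h
  · exact of_rel k .red_dot_swap
  · exact slide_inv k (of_rel k .blue_dot_swap) (swap_swapInv k) (swapInv_swap k)
  · exact absurd rfl h

/-- The two dots exchange sides, which reverses the sign of right minus left. -/
theorem dotDiff_crossing (h : c ≠ c') :
    dotDiff k c c' ≫ crossing k c c' = -(crossing k c c' ≫ dotDiff k c' c) := by
  rw [dotDiff, dotDiff, Preadditive.sub_comp, left_dot_crossing h, right_dot_crossing h,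
    Preadditive.comp_sub, neg_sub]

/-- The sign in the red-blue case of `dumbbell` makes this hold for both orders of the colours, so
that later statements can be proved for an arbitrary pair `c ≠ c'`. -/
theorem dumbbell_flip (h : c ≠ c') :
    dumbbell k c' c = -(crossing k c' c ≫ dumbbell k c c' ≫ crossing k c c') := by
  cases c <;> cases c'
  · exact absurd rfl h
  · rfl
  · change dumbbellBR k = -(crossing k blue red ≫ (-dumbbellRB k) ≫ crossing k red blue)
    rw [dumbbellRB]
    simp only [Preadditive.neg_comp, Preadditive.comp_neg, neg_neg, Category.assoc,
      crossing_crossing, Category.comp_id]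
    rw [reassoc_of% (crossing_crossing k blue red)]
  · exact absurd rfl h

theorem dotted_eq_dotDiff : (Pres.hom (dotted (k := k)) : up k blue ⊗ up k red ⟶ up k blue ⊗ up k red) = dotDiff k blue red := by
  change up k blue ◁ dot k red + (-1 : k) • dot k blue ▷ up k red =
    up k blue ◁ dot k red - dot k blue ▷ up k red
  rw [neg_one_smul, sub_eq_add_neg]

theorem dotDiff_dumbbell (h : c ≠ c') : dotDiff k c c' ≫ dumbbell k c c' = 𝟙 _ := by
  have hbr : dotDiff k blue red ≫ dumbbell k blue red = 𝟙 _ := by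
    rw [← dotted_eq_dotDiff]; exact of_rel k .dotted_dumbbell
  cases c <;> cases c'
  · exact absurd rfl h
  · exact hbr
  -- The red-blue case is conjugate to the blue-red one; the signs of the dumbbell and of the
  -- difference of dots cancel.
  · rw [dumbbell_flip (c := blue) (c' := red) nofun, Preadditive.comp_neg, ← Category.assoc, dotDiff_crossing h]
    simp [reassoc_of% hbr, crossing_crossing]
  · exact absurd rfl h

theorem dumbbell_dotDiff (h : c ≠ c') : dumbbell k c c' ≫ dotDiff k c c' = 𝟙 _ := by
  have hbr : dumbbell k blue red ≫ dotDiff k blue red = 𝟙 _ := by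
    rw [← dotted_eq_dotDiff]; exact of_rel k .dumbbell_dotted
  have hd := dotDiff_crossing (k := k) (c := blue) (c' := red) nofun
  cases c <;> cases c'
  · exact absurd rfl h
  · exact hbr
  · rw [dumbbell_flip (c := blue) (c' := red) nofun, Preadditive.neg_comp, Category.assoc,
      Category.assoc, ← Preadditive.comp_neg, ← Preadditive.comp_neg, ← hd, reassoc_of% hbr,
      crossing_crossing]
  · exact absurd rfl h

theorem comulCrossingEntry_same (c : Colour) : comulCrossingEntry k c c c c = crossing k c c := by
  cases c <;> rfl

/-- The opposite signs in front of the two dumbbell terms of Δ(s) are absorbed by the sign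
convention for `dumbbell`. -/
theorem comulCrossingEntry_swap (h : c ≠ c') :
    comulCrossingEntry k c c' c' c = (𝟙 _ - dumbbell k c c') ≫ crossing k c c' := by
  cases c <;> cases c'
  · exact absurd rfl h
  · simp [comulCrossingEntry, dumbbell]
  · simp [comulCrossingEntry, dumbbell]
  · exact absurd rfl h

theorem comulCrossingEntry_dumbbell (h : c ≠ c') :
    comulCrossingEntry k c c' c c' = -dumbbell k c c' := by
  cases c <;> cases c'
  · exact absurd rfl h
  · rfl
  · exact (neg_neg _).symm
  · exact absurd rfl h

/-! Morphisms of two adjacent strings among three. -/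

section ThreeStrings

variable {a b a' b' a'' b'' : Colour}

/-- A morphism of the two left strings of three. -/
def onLeft (f : up k a ⊗ up k b ⟶ up k a' ⊗ up k b') (c : Colour) :
    (⟨[a, b, c]⟩ : AHAH k) ⟶ ⟨[a', b', c]⟩ :=
  f ▷ up k c

/-- A morphism of the two right strings of three. -/
def onRight (c : Colour) (f : up k a ⊗ up k b ⟶ up k a' ⊗ up k b') :
    (⟨[c, a, b]⟩ : AHAH k) ⟶ ⟨[c, a', b']⟩ :=
  up k c ◁ f

theorem onLeft_comp (f : up k a ⊗ up k b ⟶ up k a' ⊗ up k b')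
    (g : up k a' ⊗ up k b' ⟶ up k a'' ⊗ up k b'') (c : Colour) :
    onLeft (f ≫ g) c = onLeft f c ≫ onLeft g c := comp_whiskerRight _ _ _

theorem onRight_comp (f : up k a ⊗ up k b ⟶ up k a' ⊗ up k b')
    (g : up k a' ⊗ up k b' ⟶ up k a'' ⊗ up k b'') (c : Colour) :
    onRight c (f ≫ g) = onRight c f ≫ onRight c g := MonoidalCategory.whiskerLeft_comp _ _ _

theorem onLeft_id (a b c : Colour) : onLeft (𝟙 (up k a ⊗ up k b)) c = 𝟙 _ := id_whiskerRight _ _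

theorem onRight_id (a b c : Colour) : onRight c (𝟙 (up k a ⊗ up k b)) = 𝟙 _ :=
  MonoidalCategory.whiskerLeft_id _ _

variable (f g : up k a ⊗ up k b ⟶ up k a' ⊗ up k b') (c : Colour)

theorem onLeft_zero : onLeft (0 : up k a ⊗ up k b ⟶ up k a' ⊗ up k b') c = 0 :=
  MonoidalPreadditive.zero_whiskerRight

theorem onRight_zero : onRight c (0 : up k a ⊗ up k b ⟶ up k a' ⊗ up k b') = 0 :=
  MonoidalPreadditive.whiskerLeft_zero

theorem onLeft_add : onLeft (f + g) c = onLeft f c + onLeft g c :=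
  MonoidalPreadditive.add_whiskerRight _ _

theorem onRight_add : onRight c (f + g) = onRight c f + onRight c g :=
  MonoidalPreadditive.whiskerLeft_add _ _

theorem onLeft_neg : onLeft (-f) c = -onLeft f c := by
  rw [eq_neg_iff_add_eq_zero, ← onLeft_add, neg_add_cancel, onLeft_zero]

theorem onRight_neg : onRight c (-f) = -onRight c f := by
  rw [eq_neg_iff_add_eq_zero, ← onRight_add, neg_add_cancel, onRight_zero]

theorem onLeft_sub : onLeft (f - g) c = onLeft f c - onLeft g c := by
  rw [sub_eq_add_neg, sub_eq_add_neg, onLeft_add, onLeft_neg]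

theorem onRight_sub : onRight c (f - g) = onRight c f - onRight c g := by
  rw [sub_eq_add_neg, sub_eq_add_neg, onRight_add, onRight_neg]

/-- The middle dot of three strings. -/
theorem onLeft_whiskerLeft (a b c : Colour) :
    onLeft (up k a ◁ dot k b) c = onRight a (dot k b ▷ up k c) :=
  (MonoidalCategory.whisker_assoc (up k a) (dot k b) (up k c)).trans
    ((Category.id_comp _).trans (Category.comp_id _))

/-- The left dot of three strings commutes with morphisms of the two right strings. -/
theorem onLeft_dot_onRight (a : Colour) {b c b' c' : Colour}
    (f : up k b ⊗ up k c ⟶ up k b' ⊗ up k c') :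
    onLeft (dot k a ▷ up k b) c ≫ onRight a f = onRight a f ≫ onLeft (dot k a ▷ up k b') c' := by
  have e : ∀ b c : Colour, onLeft (dot k a ▷ up k b) c = dot k a ▷ (up k b ⊗ up k c) :=
    fun b c => ((MonoidalCategory.whiskerRight_tensor (dot k a) (up k b) (up k c)).trans
      ((Category.id_comp _).trans (Category.comp_id _))).symm
  rw [e, e]
  exact (whisker_exchange (dot k a) f).symm

/-- The right dot of three strings commutes with morphisms of the two left strings. -/
theorem onLeft_onRight_dot (c : Colour) {a b a' b' : Colour}
    (f : up k a ⊗ up k b ⟶ up k a' ⊗ up k b') :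
    onLeft f c ≫ onRight a' (up k b' ◁ dot k c) = onRight a (up k b ◁ dot k c) ≫ onLeft f c := by
  have e : ∀ a b : Colour, onRight a (up k b ◁ dot k c) = (up k a ⊗ up k b) ◁ dot k c :=
    fun a b => ((MonoidalCategory.tensor_whiskerLeft (up k a) (up k b) (dot k c)).trans
      ((Category.id_comp _).trans (Category.comp_id _))).symm
  rw [e, e]
  exact (whisker_exchange f (dot k c)).symm

end ThreeStrings

/-- Naturality of the two-colour crossing with respect to a one-colour crossing: the pair of equal
strings may cross before or after the other string has passed. For red pairs it is obtained by
inverting the defining relation. -/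
theorem crossing_slide (h : c ≠ c') :
    onLeft (crossing k c c) c' ≫ onRight c (crossing k c c') ≫ onLeft (crossing k c c') c =
      onRight c (crossing k c c') ≫ onLeft (crossing k c c') c ≫ onRight c' (crossing k c c) := by
  -- The defining relation treats the two two-colour crossings as a single composite, so the
  -- right-hand side must be rebracketed.
  refine Eq.trans ?_ (Category.assoc _ _ _)
  cases c <;> cases c'
  · exact absurd rfl h
  · exact of_rel k .blue_cross_swap
  · exact slide_inv k (f := Pres.hom (s₂ blue red)) (g := Pres.hom (s₁ red blue))
      (of_rel k .red_cross_swap) (σbrr_τrrb k) (τrrb_σbrr k)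
  · exact absurd rfl h

theorem braid_same (c : Colour) :
    onLeft (crossing k c c) c ≫ onRight c (crossing k c c) ≫ onLeft (crossing k c c) c =
      onRight c (crossing k c c) ≫ onLeft (crossing k c c) c ≫ onRight c (crossing k c c) := by
  cases c
  · exact of_rel k (.braid blue)
  · exact of_rel k (.braid red)

theorem onLeft_crossing_crossing (a b c : Colour) :
    onLeft (crossing k a b) c ≫ onLeft (crossing k b a) c = 𝟙 _ := by
  rw [← onLeft_comp, crossing_crossing, onLeft_id]

theorem onRight_crossing_crossing (a b c : Colour) :
    onRight c (crossing k a b) ≫ onRight c (crossing k b a) = 𝟙 _ := by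
  rw [← onRight_comp, crossing_crossing, onRight_id]

/-- Conjugation carries the `c'` dot from the middle to the right string and leaves the left dot
alone, giving `x₃ - x₁` on the word ccc'. -/
theorem onRight_crossing_dotDiff (h : c ≠ c') :
    onRight c (crossing k c c') ≫ onLeft (dotDiff k c c') c ≫ onRight c (crossing k c' c) =
      onRight c (up k c ◁ dot k c') - onLeft (dot k c ▷ up k c) c' := by
  rw [dotDiff, onLeft_sub, onLeft_whiskerLeft, Preadditive.sub_comp, Preadditive.comp_sub,
    onLeft_dot_onRight, reassoc_of% (onRight_crossing_crossing c c' c), ← Category.assoc,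
    ← onRight_comp, ← right_dot_crossing h, onRight_comp, Category.assoc,
    onRight_crossing_crossing, Category.comp_id]

/-- On ccc' the two dumbbells invert `y = x₃ - x₂` and `z = x₃ - x₁`. The crossing of the first two
strings commutes with `x₃` and exchanges `x₁` and `x₂` up to 1, hence exchanges `y` and `z` up to
sign corrections `±1`; `MixedStrings.of_inverse` does the rest. -/
theorem mixedStrings (h : c ≠ c') :
    MixedStrings (onRight c (crossing k c c')) (onRight c (crossing k c' c))
      (onLeft (crossing k c c') c) (onLeft (crossing k c' c) c) (onLeft (crossing k c c) c')
      (onRight c (dumbbell k c c'))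
      (onRight c (crossing k c c') ≫ onLeft (dumbbell k c c') c ≫
        onRight c (crossing k c' c)) := by
  have hy : onRight c (dotDiff k c c') = onRight c (up k c ◁ dot k c') -
      onLeft (up k c ◁ dot k c) c' := by
    rw [dotDiff, onRight_sub, onLeft_whiskerLeft]
  -- The numerals in these names are string positions: `h23`, `h13`, `h12` say that dots on
  -- different strings commute, `h3s` that the third dot commutes with the crossing of the first two
  -- strings.
  have h23 : onRight c (up k c ◁ dot k c') ≫ onLeft (up k c ◁ dot k c) c' =
      onLeft (up k c ◁ dot k c) c' ≫ onRight c (up k c ◁ dot k c') :=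
    (onLeft_onRight_dot c' (up k c ◁ dot k c)).symm
  have h13 : onRight c (up k c ◁ dot k c') ≫ onLeft (dot k c ▷ up k c) c' =
      onLeft (dot k c ▷ up k c) c' ≫ onRight c (up k c ◁ dot k c') :=
    (onLeft_onRight_dot c' (dot k c ▷ up k c)).symm
  have h12 : onLeft (up k c ◁ dot k c) c' ≫ onLeft (dot k c ▷ up k c) c' =
      onLeft (dot k c ▷ up k c) c' ≫ onLeft (up k c ◁ dot k c) c' := by
    rw [← onLeft_comp, ← onLeft_comp, whisker_exchange]
  have h3s := onLeft_onRight_dot c' (crossing k c c)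
  refine .of_inverse (y := onRight c (dotDiff k c c'))
    (z := onRight c (crossing k c c') ≫ onLeft (dotDiff k c c') c ≫ onRight c (crossing k c' c))
    (onRight_crossing_crossing _ _ _) (onLeft_crossing_crossing _ _ _)
    (onLeft_crossing_crossing _ _ _) ?_ ?_ ?_ ?_ ?_ ?_ ?_
  · rw [← onRight_comp, dotDiff_dumbbell h, onRight_id]
  · rw [← onRight_comp, dumbbell_dotDiff h, onRight_id]
  · have := congrArg (onLeft · c) (dotDiff_dumbbell (k := k) h)
    simp only [onLeft_comp, onLeft_id] at this
    simp only [Category.assoc]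
    rw [reassoc_of% (onRight_crossing_crossing (k := k) c' c c), reassoc_of% this,
      onRight_crossing_crossing]
  · have := congrArg (onLeft · c) (dumbbell_dotDiff (k := k) h)
    simp only [onLeft_comp, onLeft_id] at this
    simp only [Category.assoc]
    rw [reassoc_of% (onRight_crossing_crossing (k := k) c' c c), reassoc_of% this,
      onRight_crossing_crossing]
  · rw [onRight_crossing_dotDiff h, hy]
    simp only [Preadditive.sub_comp, Preadditive.comp_sub, h23, h13, h12]
    abel
  · rw [onRight_crossing_dotDiff h, hy, Preadditive.sub_comp, Preadditive.comp_sub, h3s,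
      ← onLeft_comp, ← onLeft_comp, crossing_dot_same, onLeft_add, onLeft_id]
    abel
  · rw [onRight_crossing_dotDiff h, hy, Preadditive.sub_comp, Preadditive.comp_sub, h3s,
      ← onLeft_comp, ← onLeft_comp, dot_crossing_same, onLeft_add, onLeft_id]
    abel

end AHAH

/-! ### The braid relation for two strings of one colour and one of the other -/

namespace AHAH

variable {k : Type u} [CommRing k] {c c' : Colour}

open Colour

section Mixed

variable (h : c ≠ c')
include h

/-- In this and the following entry formulas, everything except the two-colour crossings is
conjugated back to the word ccc', so that the entries take the shape used in `MixedStrings`. -/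
theorem onLeft_entry_dumbbell : onLeft (comulCrossingEntry k c c' c c') c =
    -(onRight c (crossing k c' c) ≫ (onRight c (crossing k c c') ≫
      onLeft (dumbbell k c c') c ≫ onRight c (crossing k c' c)) ≫ onRight c (crossing k c c')) := by
  rw [comulCrossingEntry_dumbbell h, onLeft_neg]
  simp only [Category.assoc, onRight_crossing_crossing, Category.comp_id]
  rw [reassoc_of% (onRight_crossing_crossing (k := k) c' c c)]

theorem onLeft_entry_swap : onLeft (comulCrossingEntry k c c' c' c) c =
    onRight c (crossing k c' c) ≫ (𝟙 _ - onRight c (crossing k c c') ≫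
      onLeft (dumbbell k c c') c ≫ onRight c (crossing k c' c)) ≫
        onRight c (crossing k c c') ≫ onLeft (crossing k c c') c := by
  rw [comulCrossingEntry_swap h, onLeft_comp, onLeft_sub, onLeft_id]
  simp only [Category.assoc, Preadditive.sub_comp, Preadditive.comp_sub, Category.id_comp,
    reassoc_of% (onRight_crossing_crossing (k := k) c' c c)]

/-- The sign in `dumbbell_flip` turns `1 - d` for the opposite order of colours into 1 plus the
conjugated dumbbell, which explains the asymmetry with `onLeft_entry_swap`. -/
theorem onLeft_entry_swap_flip : onLeft (comulCrossingEntry k c' c c c') c =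
    onLeft (crossing k c' c) c ≫ onRight c (crossing k c' c) ≫
      (𝟙 _ + onRight c (crossing k c c') ≫ onLeft (dumbbell k c c') c ≫
        onRight c (crossing k c' c)) ≫ onRight c (crossing k c c') := by
  rw [comulCrossingEntry_swap h.symm, dumbbell_flip h, onLeft_comp, onLeft_sub, onLeft_neg,
    onLeft_id, onLeft_comp, onLeft_comp]
  simp only [Category.assoc, Preadditive.add_comp, Preadditive.comp_add, Preadditive.sub_comp,
    Preadditive.neg_comp, sub_neg_eq_add, Category.id_comp, Category.comp_id,
    onLeft_crossing_crossing, onRight_crossing_crossing,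
    reassoc_of% (onRight_crossing_crossing (k := k) c' c c)]

theorem onLeft_entry_dumbbell_flip : onLeft (comulCrossingEntry k c' c c' c) c =
    onLeft (crossing k c' c) c ≫ onRight c (crossing k c' c) ≫
      (onRight c (crossing k c c') ≫ onLeft (dumbbell k c c') c ≫
        onRight c (crossing k c' c)) ≫ onRight c (crossing k c c') ≫
          onLeft (crossing k c c') c := by
  rw [comulCrossingEntry_dumbbell h.symm, dumbbell_flip h, neg_neg, onLeft_comp, onLeft_comp]
  simp only [Category.assoc, reassoc_of% (onRight_crossing_crossing (k := k) c' c c)]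

theorem onRight_entry_dumbbell : onRight c (comulCrossingEntry k c c' c c') =
    -onRight c (dumbbell k c c') := by
  rw [comulCrossingEntry_dumbbell h, onRight_neg]

theorem onRight_entry_swap : onRight c (comulCrossingEntry k c c' c' c) =
    (𝟙 _ - onRight c (dumbbell k c c')) ≫ onRight c (crossing k c c') := by
  rw [comulCrossingEntry_swap h, onRight_comp, onRight_sub, onRight_id]

theorem onRight_entry_swap_flip : onRight c (comulCrossingEntry k c' c c c') =
    onRight c (crossing k c' c) ≫ (𝟙 _ + onRight c (dumbbell k c c')) := by
  rw [comulCrossingEntry_swap h.symm, dumbbell_flip h, onRight_comp, onRight_sub, onRight_neg,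
    onRight_id, onRight_comp, onRight_comp]
  simp only [Category.assoc, Preadditive.add_comp, Preadditive.comp_add, Preadditive.sub_comp,
    Preadditive.neg_comp, sub_neg_eq_add, Category.id_comp, Category.comp_id,
    onRight_crossing_crossing]

theorem onRight_entry_dumbbell_flip : onRight c (comulCrossingEntry k c' c c' c) =
    onRight c (crossing k c' c) ≫ onRight c (dumbbell k c c') ≫ onRight c (crossing k c c') := by
  rw [comulCrossingEntry_dumbbell h.symm, dumbbell_flip h, neg_neg, onRight_comp, onRight_comp]

/-- This is `crossing_slide` solved for the crossing on c'cc. -/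
theorem onRight_entry_same : onRight c' (comulCrossingEntry k c c c c) =
    onLeft (crossing k c' c) c ≫ onRight c (crossing k c' c) ≫ onLeft (crossing k c c) c' ≫
      onRight c (crossing k c c') ≫ onLeft (crossing k c c') c := by
  rw [comulCrossingEntry_same, crossing_slide h,
    reassoc_of% (onRight_crossing_crossing (k := k) c' c c),
    reassoc_of% (onLeft_crossing_crossing (k := k) c' c c)]

/-- In the names of the nine `mixed_braid` lemmas, right, middle and left are the positions of the
`c'` string at the bottom and at the top, that is, the words `P`, `Q` and `R` of `MixedStrings`. -/
theorem mixed_braid_right_right :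
      onLeft (comulCrossingEntry k c c c c) c' ≫
        onRight c (comulCrossingEntry k c c' c c') ≫
        onLeft (comulCrossingEntry k c c c c) c' =
      onRight c (comulCrossingEntry k c c' c c') ≫
        onLeft (comulCrossingEntry k c c c c) c' ≫
        onRight c (comulCrossingEntry k c c' c c') +
      onRight c (comulCrossingEntry k c c' c' c) ≫
        onLeft (comulCrossingEntry k c c' c c') c ≫
        onRight c (comulCrossingEntry k c' c c c') := by
  rw [onLeft_entry_dumbbell h, onRight_entry_dumbbell h, onRight_entry_swap h, onRight_entry_swap_flip h, comulCrossingEntry_same]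
  exact (mixedStrings h).braid_PP

theorem mixed_braid_right_middle :
      onLeft (comulCrossingEntry k c c c c) c' ≫
        onRight c (comulCrossingEntry k c c' c' c) ≫
        onLeft (comulCrossingEntry k c c' c c') c =
      onRight c (comulCrossingEntry k c c' c c') ≫
        onLeft (comulCrossingEntry k c c c c) c' ≫
        onRight c (comulCrossingEntry k c c' c' c) +
      onRight c (comulCrossingEntry k c c' c' c) ≫
        onLeft (comulCrossingEntry k c c' c c') c ≫
        onRight c (comulCrossingEntry k c' c c' c) := by
  rw [onLeft_entry_dumbbell h, onRight_entry_dumbbell h, onRight_entry_swap h, onRight_entry_dumbbell_flip h, comulCrossingEntry_same]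
  exact (mixedStrings h).braid_PQ

theorem mixed_braid_right_left :
      onLeft (comulCrossingEntry k c c c c) c' ≫
        onRight c (comulCrossingEntry k c c' c' c) ≫
        onLeft (comulCrossingEntry k c c' c' c) c =
      onRight c (comulCrossingEntry k c c' c' c) ≫
        onLeft (comulCrossingEntry k c c' c' c) c ≫
        onRight c' (comulCrossingEntry k c c c c) := by
  rw [onLeft_entry_swap h, onRight_entry_swap h, onRight_entry_same h, comulCrossingEntry_same]
  exact (mixedStrings h).braid_PR

theorem mixed_braid_middle_right :
      onLeft (comulCrossingEntry k c c' c c') c ≫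
        onRight c (comulCrossingEntry k c' c c c') ≫
        onLeft (comulCrossingEntry k c c c c) c' =
      onRight c (comulCrossingEntry k c' c c c') ≫
        onLeft (comulCrossingEntry k c c c c) c' ≫
        onRight c (comulCrossingEntry k c c' c c') +
      onRight c (comulCrossingEntry k c' c c' c) ≫
        onLeft (comulCrossingEntry k c c' c c') c ≫
        onRight c (comulCrossingEntry k c' c c c') := by
  rw [onLeft_entry_dumbbell h, onRight_entry_dumbbell h, onRight_entry_swap_flip h, onRight_entry_dumbbell_flip h, comulCrossingEntry_same]
  exact (mixedStrings h).braid_QP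

theorem mixed_braid_middle_middle :
      onLeft (comulCrossingEntry k c c' c c') c ≫
        onRight c (comulCrossingEntry k c' c c' c) ≫
        onLeft (comulCrossingEntry k c c' c c') c +
      onLeft (comulCrossingEntry k c c' c' c) c ≫
        onRight c' (comulCrossingEntry k c c c c) ≫
        onLeft (comulCrossingEntry k c' c c c') c =
      onRight c (comulCrossingEntry k c' c c c') ≫
        onLeft (comulCrossingEntry k c c c c) c' ≫
        onRight c (comulCrossingEntry k c c' c' c) +
      onRight c (comulCrossingEntry k c' c c' c) ≫
        onLeft (comulCrossingEntry k c c' c c') c ≫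
        onRight c (comulCrossingEntry k c' c c' c) := by
  rw [onLeft_entry_dumbbell h, onLeft_entry_swap h, onLeft_entry_swap_flip h, onRight_entry_swap h, onRight_entry_swap_flip h, onRight_entry_dumbbell_flip h, onRight_entry_same h, comulCrossingEntry_same]
  exact (mixedStrings h).braid_QQ

theorem mixed_braid_middle_left :
      onLeft (comulCrossingEntry k c c' c c') c ≫
        onRight c (comulCrossingEntry k c' c c' c) ≫
        onLeft (comulCrossingEntry k c c' c' c) c +
      onLeft (comulCrossingEntry k c c' c' c) c ≫
        onRight c' (comulCrossingEntry k c c c c) ≫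
        onLeft (comulCrossingEntry k c' c c' c) c =
      onRight c (comulCrossingEntry k c' c c' c) ≫
        onLeft (comulCrossingEntry k c c' c' c) c ≫
        onRight c' (comulCrossingEntry k c c c c) := by
  rw [onLeft_entry_dumbbell h, onLeft_entry_swap h, onLeft_entry_dumbbell_flip h, onRight_entry_dumbbell_flip h, onRight_entry_same h]
  exact (mixedStrings h).braid_QR

theorem mixed_braid_left_right :
      onLeft (comulCrossingEntry k c' c c c') c ≫
        onRight c (comulCrossingEntry k c' c c c') ≫
        onLeft (comulCrossingEntry k c c c c) c' =
      onRight c' (comulCrossingEntry k c c c c) ≫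
        onLeft (comulCrossingEntry k c' c c c') c ≫
        onRight c (comulCrossingEntry k c' c c c') := by
  rw [onLeft_entry_swap_flip h, onRight_entry_swap_flip h, onRight_entry_same h, comulCrossingEntry_same]
  exact (mixedStrings h).braid_RP

theorem mixed_braid_left_middle :
      onLeft (comulCrossingEntry k c' c c c') c ≫
        onRight c (comulCrossingEntry k c' c c' c) ≫
        onLeft (comulCrossingEntry k c c' c c') c +
      onLeft (comulCrossingEntry k c' c c' c) c ≫
        onRight c' (comulCrossingEntry k c c c c) ≫
        onLeft (comulCrossingEntry k c' c c c') c =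
      onRight c' (comulCrossingEntry k c c c c) ≫
        onLeft (comulCrossingEntry k c' c c c') c ≫
        onRight c (comulCrossingEntry k c' c c' c) := by
  rw [onLeft_entry_dumbbell h, onLeft_entry_swap_flip h, onLeft_entry_dumbbell_flip h, onRight_entry_dumbbell_flip h, onRight_entry_same h]
  exact (mixedStrings h).braid_RQ

theorem mixed_braid_left_left :
      onLeft (comulCrossingEntry k c' c c c') c ≫
        onRight c (comulCrossingEntry k c' c c' c) ≫
        onLeft (comulCrossingEntry k c c' c' c) c +
      onLeft (comulCrossingEntry k c' c c' c) c ≫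
        onRight c' (comulCrossingEntry k c c c c) ≫
        onLeft (comulCrossingEntry k c' c c' c) c =
      onRight c' (comulCrossingEntry k c c c c) ≫
        onLeft (comulCrossingEntry k c' c c' c) c ≫
        onRight c' (comulCrossingEntry k c c c c) := by
  rw [onLeft_entry_swap h, onLeft_entry_swap_flip h, onLeft_entry_dumbbell_flip h, onRight_entry_dumbbell_flip h, onRight_entry_same h]
  exact (mixedStrings h).braid_RR

end Mixed

end AHAH

/-! ### Matrices indexed by the colours of the strings -/

section ColourMatrices

open Colour AHAH

/-- The sum over both colours. -/
def colourSum {M : Type u} [AddCommGroup M] (g : Colour → M) : M := g blue + g red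

variable (k : Type u) [CommRing k]

/-- The matrix entries of the image of the crossing of the two left strings of three. -/
def leftEntry : ∀ a b c a' b' c' : Colour, (⟨[a, b, c]⟩ : AHAH k) ⟶ ⟨[a', b', c']⟩
  | a, b, blue, a', b', blue => onLeft (comulCrossingEntry k a b a' b') blue
  | a, b, red, a', b', red => onLeft (comulCrossingEntry k a b a' b') red
  | _, _, _, _, _, _ => 0

/-- The matrix entries of the image of the crossing of the two right strings of three. -/
def rightEntry : ∀ a b c a' b' c' : Colour, (⟨[a, b, c]⟩ : AHAH k) ⟶ ⟨[a', b', c']⟩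
  | blue, b, c, blue, b', c' => onRight blue (comulCrossingEntry k b c b' c')
  | red, b, c, red, b', c' => onRight red (comulCrossingEntry k b c b' c')
  | _, _, _, _, _, _ => 0

/-- The product of matrices indexed by the colours of three strings. -/
def colourMul (A B : ∀ a b c a' b' c' : Colour, (⟨[a, b, c]⟩ : AHAH k) ⟶ ⟨[a', b', c']⟩)
    (a b c a' b' c' : Colour) : (⟨[a, b, c]⟩ : AHAH k) ⟶ ⟨[a', b', c']⟩ :=
  colourSum fun x => colourSum fun y => colourSum fun z => A a b c x y z ≫ B x y z a' b' c'

-- Entries between words with different numbers of blue strings vanish on both sides. Of the 64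
-- entries this leaves 1 + 9 + 9 + 1 = 20: the two one-colour cases and nine entries for each choice
-- of the repeated colour.
set_option maxHeartbeats 1000000 in
theorem colourMul_braid (a b c a' b' c' : Colour) :
    colourMul k (leftEntry k) (colourMul k (rightEntry k) (leftEntry k)) a b c a' b' c' =
      colourMul k (rightEntry k) (colourMul k (leftEntry k) (rightEntry k)) a b c a' b' c' := by
  have hbr : blue ≠ red := nofun
  have hrb : red ≠ blue := nofun
  have z₁ : comulCrossingEntry k blue blue blue red = 0 := rfl
  have z₂ : comulCrossingEntry k blue blue red blue = 0 := rfl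
  have z₃ : comulCrossingEntry k blue blue red red = 0 := rfl
  have z₄ : comulCrossingEntry k blue red blue blue = 0 := rfl
  have z₅ : comulCrossingEntry k blue red red red = 0 := rfl
  have z₆ : comulCrossingEntry k red blue blue blue = 0 := rfl
  have z₇ : comulCrossingEntry k red blue red red = 0 := rfl
  have z₈ : comulCrossingEntry k red red blue blue = 0 := rfl
  have z₉ : comulCrossingEntry k red red blue red = 0 := rfl
  have z₀ : comulCrossingEntry k red red red blue = 0 := rfl
  cases a <;> cases b <;> cases c <;> cases a' <;> cases b' <;> cases c' <;>
    simp only [colourMul, colourSum, leftEntry, rightEntry, z₁, z₂, z₃, z₄, z₅, z₆, z₇, z₈, z₉,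
      z₀, onLeft_zero, onRight_zero, Limits.zero_comp, Limits.comp_zero, add_zero, zero_add]
  · simp only [comulCrossingEntry_same]
    exact braid_same blue
  · exact mixed_braid_right_right hbr
  · exact mixed_braid_right_middle hbr
  · exact mixed_braid_right_left hbr
  · exact mixed_braid_middle_right hbr
  · exact mixed_braid_middle_middle hbr
  · exact mixed_braid_middle_left hbr
  -- Intermediate colours are summed with blue first, whereas the general lemma orders its summands
  -- by the position of the odd string. For repeated colour red the two orders disagree, hence
  -- `add_comm`.
  · exact (add_comm _ _).trans (mixed_braid_left_left hrb)
  · exact (add_comm _ _).trans (mixed_braid_left_middle hrb)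
  · exact mixed_braid_left_right hrb
  · exact mixed_braid_left_right hbr
  · exact mixed_braid_left_middle hbr
  · exact mixed_braid_left_left hbr
  · exact (add_comm _ _).trans (mixed_braid_middle_left hrb)
  · exact ((add_comm _ _).trans (mixed_braid_middle_middle hrb)).trans (add_comm _ _)
  · exact (mixed_braid_middle_right hrb).trans (add_comm _ _)
  · exact mixed_braid_right_left hrb
  · exact (mixed_braid_right_middle hrb).trans (add_comm _ _)
  · exact (mixed_braid_right_right hrb).trans (add_comm _ _)
  · simp only [comulCrossingEntry_same]
    exact braid_same red

end ColourMatrices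

/-! ### Quadratic and dot relations for two strings of different colours -/

namespace AHAH

variable {k : Type u} [CommRing k] {c c' : Colour}

theorem dot_comm (c c' : Colour) : up k c ◁ dot k c' ≫ dot k c ▷ up k c' =
    dot k c ▷ up k c' ≫ up k c ◁ dot k c' := whisker_exchange _ _

/-- What commutes with an invertible morphism commutes with its inverse. -/
theorem dumbbell_comm (h : c ≠ c') {f : up k c ⊗ up k c' ⟶ up k c ⊗ up k c'}
    (hf : dotDiff k c c' ≫ f = f ≫ dotDiff k c c') :
    f ≫ dumbbell k c c' = dumbbell k c c' ≫ f := by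
  calc f ≫ dumbbell k c c' =
      dumbbell k c c' ≫ (dotDiff k c c' ≫ f) ≫ dumbbell k c c' := by
        rw [Category.assoc, reassoc_of% (dumbbell_dotDiff (k := k) h)]
    _ = dumbbell k c c' ≫ f := by
        rw [hf, Category.assoc, dotDiff_dumbbell h, Category.comp_id]

theorem left_dot_dumbbell (h : c ≠ c') :
    dot k c ▷ up k c' ≫ dumbbell k c c' = dumbbell k c c' ≫ dot k c ▷ up k c' :=
  dumbbell_comm h (by
    rw [dotDiff, Preadditive.sub_comp, Preadditive.comp_sub, dot_comm])

theorem right_dot_dumbbell (h : c ≠ c') :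
    up k c ◁ dot k c' ≫ dumbbell k c c' = dumbbell k c c' ≫ up k c ◁ dot k c' :=
  dumbbell_comm h (by
    rw [dotDiff, Preadditive.sub_comp, Preadditive.comp_sub, dot_comm])

/-- Rearranges "dumbbell times (right dot minus left dot) is 1". This is where the inhomogeneous
term of the dot relations comes from. -/
theorem dumbbell_right_dot (h : c ≠ c') : dumbbell k c c' ≫ up k c ◁ dot k c' =
    dumbbell k c c' ≫ dot k c ▷ up k c' + 𝟙 _ := by
  rw [← dumbbell_dotDiff h, dotDiff, Preadditive.comp_sub, add_sub_cancel]

/-- After the second dumbbell is moved through the crossing with a change of sign, this reads `d² +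
(1 - d)(1 + d) = 1`. -/
theorem entry_quadratic_same (h : c ≠ c') :
    comulCrossingEntry k c c' c c' ≫ comulCrossingEntry k c c' c c' +
      comulCrossingEntry k c c' c' c ≫ comulCrossingEntry k c' c c c' = 𝟙 _ := by
  rw [comulCrossingEntry_dumbbell h, comulCrossingEntry_swap h, comulCrossingEntry_swap h.symm,
    dumbbell_flip h]
  simp [reassoc_of% (crossing_crossing k c c'), crossing_crossing]

/-- The summands are `-d(1 - d)σ` and `(1 - d)dσ`, the second one after moving the dumbbell through
σ. -/
theorem entry_quadratic_swap (h : c ≠ c') :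
    comulCrossingEntry k c c' c c' ≫ comulCrossingEntry k c c' c' c +
      comulCrossingEntry k c c' c' c ≫ comulCrossingEntry k c' c c' c = 0 := by
  rw [comulCrossingEntry_dumbbell h, comulCrossingEntry_swap h, comulCrossingEntry_dumbbell h.symm,
    dumbbell_flip h]
  simp [reassoc_of% (crossing_crossing k c c')]

theorem left_dot_entry_same (h : c ≠ c') :
    dot k c ▷ up k c' ≫ comulCrossingEntry k c c' c c' =
      comulCrossingEntry k c c' c c' ≫ up k c ◁ dot k c' + 𝟙 _ := by
  rw [comulCrossingEntry_dumbbell h, Preadditive.comp_neg, Preadditive.neg_comp,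
    left_dot_dumbbell h, dumbbell_right_dot h]
  abel

/-- There is no correction term here, since dots commute with the dumbbell and slide through the
two-colour crossing. -/
theorem left_dot_entry_swap (h : c ≠ c') :
    dot k c ▷ up k c' ≫ comulCrossingEntry k c c' c' c =
      comulCrossingEntry k c c' c' c ≫ up k c' ◁ dot k c := by
  rw [comulCrossingEntry_swap h, Preadditive.sub_comp, Preadditive.sub_comp,
    Preadditive.comp_sub, Category.id_comp, Category.assoc,
    ← left_dot_crossing h, reassoc_of% (left_dot_dumbbell (k := k) h)]

theorem entry_same_left_dot (h : c ≠ c') :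
    comulCrossingEntry k c c' c c' ≫ dot k c ▷ up k c' =
      up k c ◁ dot k c' ≫ comulCrossingEntry k c c' c c' + 𝟙 _ := by
  rw [comulCrossingEntry_dumbbell h, Preadditive.comp_neg, Preadditive.neg_comp,
    right_dot_dumbbell h, dumbbell_right_dot h]
  abel

theorem entry_swap_left_dot (h : c ≠ c') :
    comulCrossingEntry k c c' c' c ≫ dot k c' ▷ up k c =
      up k c ◁ dot k c' ≫ comulCrossingEntry k c c' c' c := by
  rw [comulCrossingEntry_swap h, Preadditive.sub_comp, Preadditive.sub_comp,
    Preadditive.comp_sub, Category.id_comp, Category.assoc,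
    ← right_dot_crossing h, reassoc_of% (right_dot_dumbbell (k := k) h)]

end AHAH

/-! ### The relations for the images of the dot and the crossing, as matrices -/

section ColourMatrixMorphisms

open Colour AHAH

variable (k : Type u) [CommRing k]

/-- The matrix entries of the identity of one string. -/
def idEntry : ∀ c e : Colour, up k c ⟶ up k e
  | blue, blue => 𝟙 _
  | red, red => 𝟙 _
  | _, _ => 0

theorem entry_id_blueRed (i j : Fin 2) :
    AddEnv.entry (𝟙 (blueRed k)) i j = idEntry k (col i) (col j) := by
  fin_cases i <;> fin_cases j <;> rfl

variable {k}

/-- The endomorphism of two strings with given matrix entries. -/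
def ofEntries₂ (f : ∀ a b a' b' : Colour, up k a ⊗ up k b ⟶ up k a' ⊗ up k b') :
    blueRed k ⊗ blueRed k ⟶ blueRed k ⊗ blueRed k :=
  AddEnv.ofMatrix (A := AddEnv.tensorObj' (blueRed k) (blueRed k))
    (B := AddEnv.tensorObj' (blueRed k) (blueRed k)) fun p q =>
    f (col p.divNat) (col p.modNat) (col q.divNat) (col q.modNat)

/-- The endomorphism of three strings with given matrix entries. -/
def ofEntries₃ (f : ∀ a b c a' b' c' : Colour, (⟨[a, b, c]⟩ : AHAH k) ⟶ ⟨[a', b', c']⟩) :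
    (blueRed k ⊗ blueRed k) ⊗ blueRed k ⟶ (blueRed k ⊗ blueRed k) ⊗ blueRed k :=
  AddEnv.ofMatrix
    (A := AddEnv.tensorObj' (AddEnv.tensorObj' (blueRed k) (blueRed k)) (blueRed k))
    (B := AddEnv.tensorObj' (AddEnv.tensorObj' (blueRed k) (blueRed k)) (blueRed k)) fun p q =>
    f (col p.divNat.divNat) (col p.divNat.modNat) (col p.modNat)
      (col q.divNat.divNat) (col q.divNat.modNat) (col q.modNat)

/-- The lexicographic numbering of the summands runs through the colours of the strings with blue
before red, so a sum over indices is an iterated sum over colours. -/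
theorem sum_colour₂ {M : Type u} [AddCommGroup M] (g : Colour → Colour → M) :
    ∑ r : Fin (2 * 2), g (col r.divNat) (col r.modNat) =
      colourSum fun a => colourSum fun b => g a b := by
  refine (Fin.sum_univ_four _).trans ?_
  simp only [colourSum, ← add_assoc]
  rfl

theorem sum_colour₃ {M : Type u} [AddCommGroup M] (g : Colour → Colour → Colour → M) :
    ∑ r : Fin (2 * 2 * 2), g (col r.divNat.divNat) (col r.divNat.modNat) (col r.modNat) =
      colourSum fun a => colourSum fun b => colourSum fun c => g a b c := by
  refine (Fin.sum_univ_eight _).trans ?_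
  simp only [colourSum, ← add_assoc]
  rfl

theorem ofEntries₂_comp (f g : ∀ a b a' b' : Colour, up k a ⊗ up k b ⟶ up k a' ⊗ up k b') :
    ofEntries₂ f ≫ ofEntries₂ g = ofEntries₂ fun a b a' b' =>
      colourSum fun x => colourSum fun y => f a b x y ≫ g x y a' b' := by
  ext p q
  exact sum_colour₂ fun x y => f _ _ x y ≫ g x y _ _

theorem ofEntries₃_comp
    (f g : ∀ a b c a' b' c' : Colour, (⟨[a, b, c]⟩ : AHAH k) ⟶ ⟨[a', b', c']⟩) :
    ofEntries₃ f ≫ ofEntries₃ g = ofEntries₃ (colourMul k f g) := by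
  ext p q
  exact sum_colour₃ fun x y z => f _ _ _ x y z ≫ g x y z _ _ _

theorem ofEntries₂_add (f g : ∀ a b a' b' : Colour, up k a ⊗ up k b ⟶ up k a' ⊗ up k b') :
    ofEntries₂ f + ofEntries₂ g = ofEntries₂ fun a b a' b' => f a b a' b' + g a b a' b' := rfl

theorem tensorHom_eq_ofEntries₂ (f g : blueRed k ⟶ blueRed k)
    (f' g' : ∀ c e : Colour, up k c ⟶ up k e)
    (hf : ∀ i j, AddEnv.entry f i j = f' (col i) (col j))
    (hg : ∀ i j, AddEnv.entry g i j = g' (col i) (col j)) :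
    (f ⊗ₘ g) = ofEntries₂ fun a b a' b' => f' a a' ⊗ₘ g' b b' := by
  ext p q
  rw [AddEnv.tensorHom_entry, hf, hg]
  rfl

theorem id_eq_ofEntries₂ : 𝟙 (blueRed k ⊗ blueRed k) =
    ofEntries₂ fun a b a' b' => idEntry k a a' ⊗ₘ idEntry k b b' := by
  rw [← id_tensorHom_id]
  exact tensorHom_eq_ofEntries₂ _ _ _ _ (entry_id_blueRed k) (entry_id_blueRed k)

theorem comulDot_whiskerRight : comulDot k ▷ blueRed k =
    ofEntries₂ fun a b a' b' => comulDotEntry k a a' ⊗ₘ idEntry k b b' := by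
  rw [← tensorHom_id]
  exact tensorHom_eq_ofEntries₂ _ _ _ _ (fun _ _ => rfl) (entry_id_blueRed k)

theorem comulDot_whiskerLeft : blueRed k ◁ comulDot k =
    ofEntries₂ fun a b a' b' => idEntry k a a' ⊗ₘ comulDotEntry k b b' := by
  rw [← id_tensorHom]
  exact tensorHom_eq_ofEntries₂ _ _ _ _ (entry_id_blueRed k) (fun _ _ => rfl)

theorem comulCrossing_eq_ofEntries₂ : comulCrossing k = ofEntries₂ (comulCrossingEntry k) := rfl

theorem tensor_idEntry (a b c a' b' c' : Colour) :
    (comulCrossingEntry k a b a' b' ⊗ₘ idEntry k c c') = leftEntry k a b c a' b' c' := by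
  cases c <;> cases c'
  · exact tensorHom_id _ _
  · exact MonoidalPreadditive.tensor_zero _
  · exact MonoidalPreadditive.tensor_zero _
  · exact tensorHom_id _ _

theorem idEntry_tensor (a b c a' b' c' : Colour) :
    (idEntry k a a' ⊗ₘ comulCrossingEntry k b c b' c') = rightEntry k a b c a' b' c' := by
  cases a <;> cases a'
  · exact id_tensorHom _ _
  · exact MonoidalPreadditive.zero_tensor _
  · exact MonoidalPreadditive.zero_tensor _
  · exact id_tensorHom _ _

/-- The associator reindexes summands, and the colours read off from the two bracketings agree only
propositionally. Keeping them as separate variables with equations allows all transports to be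
eliminated by substitution. -/
theorem idEntry_tensor_conj {a b c a' b' c' x y z x' y' z' : Colour} (ha : x = a) (hb : y = b)
    (hc : z = c) (ha' : x' = a') (hb' : y' = b') (hc' : z' = c')
    (h : (⟨[a, b, c]⟩ : AHAH k) = up k x ⊗ up k y ⊗ up k z)
    (h' : up k x' ⊗ up k y' ⊗ up k z' = (⟨[a', b', c']⟩ : AHAH k)) :
    eqToHom h ≫ (idEntry k x x' ⊗ₘ comulCrossingEntry k y z y' z') ≫ eqToHom h' =
      rightEntry k a b c a' b' c' := by
  subst ha hb hc ha' hb' hc'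
  exact (Category.id_comp _).trans ((Category.comp_id _).trans (idEntry_tensor _ _ _ _ _ _))

theorem comulCrossing_whiskerRight : comulCrossing k ▷ blueRed k = ofEntries₃ (leftEntry k) := by
  rw [← tensorHom_id]
  ext p q
  rw [AddEnv.tensorHom_entry, entry_id_blueRed]
  exact tensor_idEntry _ _ _ _ _ _

theorem comulCrossing_whiskerLeft :
    (α_ (blueRed k) (blueRed k) (blueRed k)).hom ≫ blueRed k ◁ comulCrossing k ≫
      (α_ (blueRed k) (blueRed k) (blueRed k)).inv = ofEntries₃ (rightEntry k) := by
  rw [← id_tensorHom]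
  ext p q
  refine (AddEnv.eqToHom_comp_entry (AddEnv.tensorObj_assoc (blueRed k) (blueRed k) (blueRed k))
    _ p q).trans ?_
  refine (congrArg (_ ≫ ·) (AddEnv.comp_eqToHom_entry _
    (AddEnv.tensorObj_assoc (blueRed k) (blueRed k) (blueRed k)).symm _ q)).trans ?_
  rw [AddEnv.tensorHom_entry, entry_id_blueRed]
  exact idEntry_tensor_conj (congrArg col (AddEnv.fin_div_div (a := 2) (b := 2) p).symm)
    (congrArg col (AddEnv.fin_div_mod (a := 2) (b := 2) p).symm)
    (congrArg col (AddEnv.fin_mod_mod (a := 2) (b := 2) p).symm)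
    (congrArg col (AddEnv.fin_div_div (a := 2) (b := 2) q).symm)
    (congrArg col (AddEnv.fin_div_mod (a := 2) (b := 2) q).symm)
    (congrArg col (AddEnv.fin_mod_mod (a := 2) (b := 2) q).symm) _ _

/-- Both factors are matrices indexed by the colours of three strings, so the relation is
`colourMul_braid` entry by entry. -/
theorem comulCrossing_braid : comulCrossing k ▷ blueRed k ≫
    ((α_ (blueRed k) (blueRed k) (blueRed k)).hom ≫ blueRed k ◁ comulCrossing k ≫
      (α_ (blueRed k) (blueRed k) (blueRed k)).inv) ≫ comulCrossing k ▷ blueRed k =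
    ((α_ (blueRed k) (blueRed k) (blueRed k)).hom ≫ blueRed k ◁ comulCrossing k ≫
      (α_ (blueRed k) (blueRed k) (blueRed k)).inv) ≫ comulCrossing k ▷ blueRed k ≫
        ((α_ (blueRed k) (blueRed k) (blueRed k)).hom ≫ blueRed k ◁ comulCrossing k ≫
          (α_ (blueRed k) (blueRed k) (blueRed k)).inv) := by
  rw [comulCrossing_whiskerLeft, comulCrossing_whiskerRight]
  simp only [ofEntries₃_comp]
  congr 1
  funext a b c a' b' c'
  exact colourMul_braid k a b c a' b' c'

theorem comulCrossing_quadratic : comulCrossing k ≫ comulCrossing k = 𝟙 _ := by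
  rw [comulCrossing_eq_ofEntries₂, ofEntries₂_comp, id_eq_ofEntries₂]
  congr 1
  funext a b a' b'
  have hbr : blue ≠ red := nofun
  have q₁ := entry_quadratic_same (k := k) hbr
  have q₂ := entry_quadratic_swap (k := k) hbr
  have q₃ := entry_quadratic_same (k := k) hbr.symm
  have q₄ := entry_quadratic_swap (k := k) hbr.symm
  -- Sums over intermediate colours list blue-red before red-blue, the reverse of the order in the
  -- lemmas for red on the left.
  rw [add_comm] at q₃ q₄
  cases a <;> cases b <;> cases a' <;> cases b' <;>
    simp_all [colourSum, comulCrossingEntry, idEntry, crossing_crossing,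
      MonoidalPreadditive.tensor_zero, MonoidalPreadditive.zero_tensor]

theorem comulDot_comulCrossing : comulDot k ▷ blueRed k ≫ comulCrossing k =
    comulCrossing k ≫ blueRed k ◁ comulDot k + 𝟙 _ := by
  rw [comulCrossing_eq_ofEntries₂, comulDot_whiskerRight, comulDot_whiskerLeft, ofEntries₂_comp,
    ofEntries₂_comp, id_eq_ofEntries₂, ofEntries₂_add]
  congr 1
  funext a b a' b'
  have hbr : blue ≠ red := nofun
  have q₁ := left_dot_entry_same (k := k) hbr
  have q₂ := left_dot_entry_swap (k := k) hbr
  have q₃ := left_dot_entry_same (k := k) hbr.symm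
  have q₄ := left_dot_entry_swap (k := k) hbr.symm
  cases a <;> cases b <;> cases a' <;> cases b' <;>
    simp_all [colourSum, comulCrossingEntry, comulDotEntry, idEntry, dot_crossing_same,
      MonoidalPreadditive.tensor_zero, MonoidalPreadditive.zero_tensor]

theorem comulCrossing_comulDot : comulCrossing k ≫ comulDot k ▷ blueRed k =
    blueRed k ◁ comulDot k ≫ comulCrossing k + 𝟙 _ := by
  rw [comulCrossing_eq_ofEntries₂, comulDot_whiskerRight, comulDot_whiskerLeft, ofEntries₂_comp,
    ofEntries₂_comp, id_eq_ofEntries₂, ofEntries₂_add]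
  congr 1
  funext a b a' b'
  have hbr : blue ≠ red := nofun
  have q₁ := entry_same_left_dot (k := k) hbr
  have q₂ := entry_swap_left_dot (k := k) hbr
  have q₃ := entry_same_left_dot (k := k) hbr.symm
  have q₄ := entry_swap_left_dot (k := k) hbr.symm
  cases a <;> cases b <;> cases a' <;> cases b' <;>
    simp_all [colourSum, comulCrossingEntry, comulDotEntry, idEntry, crossing_dot_same,
      MonoidalPreadditive.tensor_zero, MonoidalPreadditive.zero_tensor]

/-- The comultiplication on the dot and the crossing satisfies the relations of the degenerate
affine Hecke category. -/
theorem isAffineHecke_comul : IsAffineHecke (comulDot k) (comulCrossing k) where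
  quadratic := comulCrossing_quadratic
  braid := comulCrossing_braid
  dot_cross := comulDot_comulCrossing
  cross_dot := comulCrossing_comulDot

end ColourMatrixMorphisms

/-! ### Reorderings of formal direct sums -/

namespace AddEnv

section Reordering

variable {C : Type v} [Category.{u} C] [Preadditive C]

theorem eqToHom_tensorHom_eqToHom {D : Type v} [Category.{u} D] [MonoidalCategory D]
    {X X' Y Y' : D} (h : X = Y) (h' : X' = Y') :
    (eqToHom h ⊗ₘ eqToHom h') = eqToHom (by rw [h, h']) := by
  subst h h'; simp

theorem isReordering_id (A : AddEnv C) : IsReordering (𝟙 A) :=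
  ⟨Equiv.refl _, fun _ => rfl, rfl⟩

theorem isReordering_eqToHom {A B : AddEnv C} (h : A = B) : IsReordering (eqToHom h) := by
  subst h; exact isReordering_id A

theorem IsReordering.conj {A A' B B' : AddEnv C} {f : A ⟶ B} (hf : IsReordering f)
    (p : A' = A) (q : B = B') : IsReordering (eqToHom p ≫ f ≫ eqToHom q) := by
  subst p q; simpa using hf

/-- The inverse is the transposed permutation matrix; in each product only one intermediate index
contributes. -/
theorem IsReordering.isIso {A B : AddEnv C} {f : A ⟶ B} (hf : IsReordering f) : IsIso f := by
  obtain ⟨e, h, rfl⟩ := hf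
  refine ⟨ofMatrix fun j i => if hij : e i = j then
    eqToHom ((congrArg B.X hij).symm.trans (h i).symm) else 0, ?_, ?_⟩
  · ext i i'
    rw [comp_entry, Finset.sum_eq_single (e i), id_entry]
    · by_cases hi : i = i'
      · subst hi; simp
      · have hi' : ¬ e i' = e i := fun h => hi (e.injective h).symm
        simp [hi, hi']
    · intro j _ hj
      simp [hj.symm]
    · simp
  · ext j j'
    obtain ⟨i, rfl⟩ := e.surjective j
    rw [comp_entry, Finset.sum_eq_single i, id_entry]
    · by_cases hj : e i = j'
      · subst hj; simp
      · simp [hj]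
    · intro i' _ hi'
      have : ¬ e i' = e i := fun h => hi' (e.injective h)
      simp [this]
    · simp

variable [MonoidalCategory C] [StrictMonoidalCategory C] [MonoidalPreadditive C]

/-- The Kronecker product of two permutation matrices is the permutation matrix of the product
bijection, read through the lexicographic numbering of pairs. -/
theorem IsReordering.tensor {A A' B B' : AddEnv C} {f : A ⟶ B} {g : A' ⟶ B'}
    (hf : IsReordering f) (hg : IsReordering g) : IsReordering (f ⊗ₘ g) := by
  obtain ⟨e, h, rfl⟩ := hf
  obtain ⟨e', h', rfl⟩ := hg
  let E : Fin (A.n * A'.n) ≃ Fin (B.n * B'.n) :=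
    finProdFinEquiv.symm.trans ((e.prodCongr e').trans finProdFinEquiv)
  have hE : ∀ p, (E p).divNat = e p.divNat ∧ (E p).modNat = e' p.modNat := fun p =>
    Prod.ext_iff.mp (finProdFinEquiv.symm_apply_apply (e p.divNat, e' p.modNat))
  have hX : ∀ p : Fin (A.n * A'.n), A.X p.divNat ⊗ A'.X p.modNat =
      B.X (E p).divNat ⊗ B'.X (E p).modNat := fun p => by
    rw [(hE p).1, (hE p).2, ← h, ← h']
  refine ⟨E, hX, ?_⟩
  ext p q
  rw [tensorHom_entry]
  simp only [entry_ofMatrix]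
  have hpq : E p = q ↔ e p.divNat = q.divNat ∧ e' p.modNat = q.modNat := by
    rw [fin_eq_iff, (hE p).1, (hE p).2]
  by_cases h₁ : e (Fin.divNat (m := A.n) (n := A'.n) p) = Fin.divNat (m := B.n) (n := B'.n) q
  · by_cases h₂ : e' (Fin.modNat (m := A.n) (n := A'.n) p) = Fin.modNat (m := B.n) (n := B'.n) q
    · rw [dif_pos h₁, dif_pos h₂, dif_pos (hpq.mpr ⟨h₁, h₂⟩), eqToHom_tensorHom_eqToHom]
    · rw [dif_neg h₂, dif_neg fun h => h₂ (hpq.mp h).2, MonoidalPreadditive.tensor_zero]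
  · rw [dif_neg h₁, dif_neg fun h => h₁ (hpq.mp h).1, MonoidalPreadditive.zero_tensor]

end Reordering

end AddEnv

section ReorderedPowers

variable {k : Type u} [CommRing k]

section

variable {D : Type v} [Category.{u} D] [MonoidalCategory D] [StrictMonoidalCategory D]
  {F F' : AH k ⥤ D} (hF : IsStrictMonoidal F) (hF' : IsStrictMonoidal F')
  (t : F.obj (AH.up k) ⟶ F'.obj (AH.up k))

theorem powApp_one : powApp hF hF' t [()] = t := by
  have e : powApp hF hF' t [] = eqToHom hF.obj_unit ≫ 𝟙 (𝟙_ D) ≫ eqToHom hF'.obj_unit.symm := by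
    simp [powApp]
  rw [powApp_cons, e, tensorHom_conj, strict_unit_right]
  simp only [Category.assoc, eqToHom_trans, eqToHom_trans_assoc]
  exact (Category.id_comp _).trans (Category.comp_id _)

theorem powApp_two : powApp hF hF' t [(), ()] =
    eqToHom (hF.obj_tensor (AH.up k) (AH.up k)) ≫ (t ⊗ₘ t) ≫
      eqToHom (hF'.obj_tensor (AH.up k) (AH.up k)).symm :=
  (powApp_append hF hF' t [()] [()]).trans (by rw [powApp_one])

end

/-- Reorderings contain the transports and are closed under tensor products and under conjugation by
transports. -/
theorem powApp_isReordering {C : Type v} [Category.{u} C] [Preadditive C] [MonoidalCategory C]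
    [StrictMonoidalCategory C] [MonoidalPreadditive C] {F F' : AH k ⥤ AddEnv C}
    (hF : IsStrictMonoidal F) (hF' : IsStrictMonoidal F')
    {t : F.obj (AH.up k) ⟶ F'.obj (AH.up k)} (ht : AddEnv.IsReordering t) :
    ∀ a, AddEnv.IsReordering (powApp hF hF' t a)
  | [] => AddEnv.isReordering_eqToHom _
  | _ :: l => (ht.tensor (powApp_isReordering hF hF' ht l)).conj _ _

end ReorderedPowers

/-! ### Symmetry of the comultiplication -/

section Symmetry

variable (k : Type u) [CommRing k]

open AHAH Colour

theorem reorder_isReordering : AddEnv.IsReordering (reorder k) := by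
  refine ⟨Equiv.swap (0 : Fin 2) (1 : Fin 2), fun i => ?_, ?_⟩
  · fin_cases i <;> rfl
  · ext i j
    fin_cases i <;> fin_cases j <;> rfl

theorem eta_dumbbellBR : (eta k).map (dumbbellBR k) = -dumbbellRB k := rfl

theorem eta_dumbbellRB : (eta k).map (dumbbellRB k) = -dumbbellBR k := by
  rw [dumbbellRB, Functor.map_comp, Functor.map_comp, eta_dumbbellBR]
  change crossing k blue red ≫ (-dumbbellRB k) ≫ crossing k red blue = _
  rw [dumbbellRB, Preadditive.neg_comp, Preadditive.comp_neg, Category.assoc, Category.assoc,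
    crossing_crossing, reassoc_of% (crossing_crossing k blue red), Category.comp_id]

/-- Exchanging the colours turns `-d_br` into `d_rb` and `-d_br ≫ σ` into `d_rb ≫ σ⁻¹` exactly
because η introduces a sign for each dumbbell. Entries without dumbbells agree definitionally. -/
theorem eta_comulCrossingEntry (c c' e e' : Colour) :
    (eta k).map (comulCrossingEntry k c c' e e') =
      comulCrossingEntry k c.flip c'.flip e.flip e'.flip := by
  have hBR := eta_dumbbellBR k
  have hRB := eta_dumbbellRB k
  cases c <;> cases c' <;> cases e <;> cases e' <;> try rfl
  · exact (Functor.map_neg _).trans (congrArg Neg.neg hBR |>.trans (neg_neg _))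
  · refine (Functor.map_sub _).trans ?_
    rw [Functor.map_comp, hBR]
    exact (congrArg (_ - ·) (Preadditive.neg_comp _ _)).trans (sub_neg_eq_add _ _)
  · refine (Functor.map_add _).trans ?_
    rw [Functor.map_comp, hRB]
    exact (congrArg (_ + ·) (Preadditive.neg_comp _ _)).trans (sub_eq_add_neg _ _).symm
  · exact hRB

theorem reorderEntry_self (c : Colour) : reorderEntry k c c = 0 := by
  cases c <;> rfl

theorem comp_reorderEntry {A : AHAH k} (c : Colour) (f : A ⟶ up k c.flip) :
    f ≫ reorderEntry k c c.flip = f := by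
  cases c <;> exact Category.comp_id f

theorem reorderEntry_comp {A : AHAH k} (c : Colour) (f : up k c.flip ⟶ A) :
    reorderEntry k c c.flip ≫ f = f := by
  cases c <;> exact Category.id_comp f

theorem comp_reorderEntry_tensor {A : AHAH k} (c c' : Colour)
    (f : A ⟶ up k c.flip ⊗ up k c'.flip) :
    f ≫ (reorderEntry k c c.flip ⊗ₘ reorderEntry k c' c'.flip) = f := by
  cases c <;> cases c' <;>
    exact (congrArg (f ≫ ·) (id_tensorHom_id _ _)).trans (Category.comp_id f)

theorem reorderEntry_tensor_comp {A : AHAH k} (c c' : Colour)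
    (f : up k c.flip ⊗ up k c'.flip ⟶ A) :
    (reorderEntry k c c.flip ⊗ₘ reorderEntry k c' c'.flip) ≫ f = f := by
  cases c <;> cases c' <;>
    exact (congrArg (· ≫ f) (id_tensorHom_id _ _)).trans (Category.id_comp f)

/-- Only the colour opposite to `e` contributes to the sum. -/
theorem colourSum_comp_reorderEntry {A : AHAH k} (f : ∀ x : Colour, A ⟶ up k x.flip)
    (e : Colour) : (colourSum fun x => f x ≫ reorderEntry k x e) =
      f e.flip ≫ reorderEntry k e.flip e := by
  cases e <;> simp only [colourSum, reorderEntry_self, Limits.comp_zero, add_zero, zero_add] <;> rfl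

theorem colourSum_comp_reorderEntry_tensor {A : AHAH k}
    (f : ∀ x y : Colour, A ⟶ up k x.flip ⊗ up k y.flip) (e e' : Colour) :
    (colourSum fun x => colourSum fun y =>
      f x y ≫ (reorderEntry k x e ⊗ₘ reorderEntry k y e')) =
      f e.flip e'.flip ≫ (reorderEntry k e.flip e ⊗ₘ reorderEntry k e'.flip e') := by
  cases e <;> cases e' <;>
    simp only [colourSum, reorderEntry_self, MonoidalPreadditive.tensor_zero,
      MonoidalPreadditive.zero_tensor, Limits.comp_zero, add_zero, zero_add] <;> rfl

theorem eta_comulDotEntry (c e : Colour) :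
    (eta k).map (comulDotEntry k c e) = comulDotEntry k c.flip e.flip := by
  cases c <;> cases e <;> rfl

theorem reorder_comulDot : (AddEnv.map (eta k)).map (comulDot k) ≫ reorder k =
    reorder k ≫ comulDot k := by
  ext i j
  change ∑ x : Fin 2, (eta k).map (comulDotEntry k (col i) (col x)) ≫
      reorderEntry k (col x) (col j) =
    ∑ x : Fin 2, reorderEntry k (col i) (col x) ≫ comulDotEntry k (col x) (col j)
  rw [Fin.sum_univ_two, Fin.sum_univ_two]
  generalize col i = c
  generalize col j = e
  -- The only entries that survive go from `c` to `e.flip` before reordering. The double flip of `e`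
  -- reduces to `e` once the colours are specified, so `h` matches the goal after the case
  -- distinction.
  have h := (comp_reorderEntry k e.flip _).trans
    ((eta_comulDotEntry k c e.flip).trans (reorderEntry_comp k c _).symm)
  refine (colourSum_comp_reorderEntry k (fun x => (eta k).map (comulDotEntry k c x)) e).trans ?_
  change _ =
    reorderEntry k c blue ≫ comulDotEntry k blue e + reorderEntry k c red ≫ comulDotEntry k red e
  cases c <;> cases e <;>
    simp only [reorderEntry_self, Limits.zero_comp, Limits.comp_zero, add_zero, zero_add] <;>
    exact h

/-- The reordering of the summands of two strings. -/
def reorder₂ : (AddEnv.map (eta k)).obj (blueRed k ⊗ blueRed k) ⟶ blueRed k ⊗ blueRed k :=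
  AddEnv.ofMatrix
    (A := (AddEnv.map (eta k)).obj (AddEnv.tensorObj' (blueRed k) (blueRed k)))
    (B := AddEnv.tensorObj' (blueRed k) (blueRed k)) fun p q =>
    reorderEntry k (col p.divNat) (col q.divNat) ⊗ₘ reorderEntry k (col p.modNat) (col q.modNat)

/-- Flipping the colours of a two-letter word and tensoring the flipped letters give definitionally
equal objects, so the entries of the transport are identities. -/
theorem reorder_tensor_reorder
    (h : (AddEnv.map (eta k)).obj (blueRed k ⊗ blueRed k) =
      (AddEnv.map (eta k)).obj (blueRed k) ⊗ (AddEnv.map (eta k)).obj (blueRed k)) :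
    eqToHom h ≫ (reorder k ⊗ₘ reorder k) = reorder₂ k := by
  ext p q
  rw [AddEnv.eqToHom_comp_entry]
  exact Category.id_comp _

theorem reorder₂_comulCrossing : (AddEnv.map (eta k)).map (comulCrossing k) ≫ reorder₂ k =
    reorder₂ k ≫ comulCrossing k := by
  ext p q
  refine (sum_colour₂ fun x y => (eta k).map (comulCrossingEntry k _ _ x y) ≫
    (reorderEntry k x _ ⊗ₘ reorderEntry k y _)).trans (Eq.trans ?_ (sum_colour₂ fun x y =>
      (reorderEntry k _ x ⊗ₘ reorderEntry k _ y) ≫ comulCrossingEntry k x y _ _).symm)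
  generalize col (Fin.divNat (m := 2) (n := 2) p) = c
  generalize col (Fin.modNat (m := 2) (n := 2) p) = c'
  generalize col (Fin.divNat (m := 2) (n := 2) q) = e
  generalize col (Fin.modNat (m := 2) (n := 2) q) = e'
  have h := (comp_reorderEntry_tensor k e.flip e'.flip _).trans
    ((eta_comulCrossingEntry k c c' e.flip e'.flip).trans (reorderEntry_tensor_comp k c c' _).symm)
  refine (colourSum_comp_reorderEntry_tensor k
    (fun x y => (eta k).map (comulCrossingEntry k c c' x y)) e e').trans ?_
  cases c <;> cases c' <;> cases e <;> cases e' <;>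
    simp only [colourSum, reorderEntry_self, MonoidalPreadditive.tensor_zero,
      MonoidalPreadditive.zero_tensor, Limits.zero_comp, Limits.comp_zero, add_zero, zero_add] <;>
    exact h

/-- The categorical comultiplication. -/
def comul : AH k ⥤ AddEnv (AHAH k) :=
  Pres.lift (tensorPow (blueRed k)) rfl (tensorPow_append (blueRed k))
    (affineHeckeGen (comulDot k) (comulCrossing k)) isAffineHecke_comul.eval_rel

instance : (comul k).Additive where
  map_add := by rintro _ _ ⟨f⟩ ⟨g⟩; rfl

instance : (comul k).Linear k where
  map_smul := by rintro _ _ ⟨f⟩ r; rfl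

theorem comul_isStrictMonoidal : IsStrictMonoidal (comul k) :=
  Pres.lift_isStrictMonoidal _ _ _ _ isAffineHecke_comul.eval_rel

theorem comul_up : (comul k).obj (AH.up k) = blueRed k := tensorPow_one _

theorem comul_up_up : (comul k).obj (AH.up k ⊗ AH.up k) = blueRed k ⊗ blueRed k :=
  tensorPow_two _

theorem comul_dot : (comul k).map (AH.dot k) =
    eqToHom (comul_up k) ≫ comulDot k ≫ eqToHom (comul_up k).symm := rfl

theorem comul_crossing : (comul k).map (AH.crossing k) =
    eqToHom (comul_up_up k) ≫ comulCrossing k ≫ eqToHom (comul_up_up k).symm := rfl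

theorem comul_eta_isStrictMonoidal : IsStrictMonoidal (comul k ⋙ AddEnv.map (eta k)) :=
  (comul_isStrictMonoidal k).comp (AddEnv.map_isStrictMonoidal (eta k) (eta_isStrictMonoidal k))

instance : (AddEnv.map (eta k)).Additive where
  map_add {A B f g} := by ext i j; exact (eta k).map_add

instance : (AddEnv.map (eta k)).Linear k where
  map_smul f r := by ext i j; exact (eta k).map_smul (R := k) _ _

/-- The component at the generating object of the symmetry of the comultiplication. -/
def comulSwap : (comul k ⋙ AddEnv.map (eta k)).obj (AH.up k) ⟶ (comul k).obj (AH.up k) :=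
  eqToHom (congrArg (AddEnv.map (eta k)).obj (comul_up k)) ≫ reorder k ≫
    eqToHom (comul_up k).symm

/-- The symmetry of the comultiplication. -/
def comulSymmetry : comul k ⋙ AddEnv.map (eta k) ⟶ comul k where
  app X := powApp (comul_eta_isStrictMonoidal k) (comul_isStrictMonoidal k) (comulSwap k) X.word
  naturality := by
    rintro X Y ⟨f⟩
    -- Choosing an expression for the morphism reduces naturality to the dot and the crossing, which
    -- are `reorder_comulDot` and `reorder₂_comulCrossing` conjugated by transports.
    refine powApp_naturality _ _ _ ?_ ?_ f
    · rw [powApp_one, comulSwap, Functor.comp_map, comul_dot, Functor.map_comp, Functor.map_comp,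
        eqToHom_map, eqToHom_map]
      simp [reassoc_of% (reorder_comulDot k)]
    · rw [powApp_two, comulSwap, Functor.comp_map, comul_crossing, Functor.map_comp,
        Functor.map_comp, eqToHom_map, eqToHom_map, conj_tensorHom, tensorHom_conj]
      have h := reorder₂_comulCrossing k
      have hη := AddEnv.map_isStrictMonoidal (eta k) (eta_isStrictMonoidal k)
      -- Replacing `reorder₂` by the tensor square of `reorder` brings the commutation with the
      -- crossing into the shape produced by `powApp_two`.
      rw [← reorder_tensor_reorder k (hη.obj_tensor _ _)] at h
      simp only [Category.assoc, eqToHom_trans, eqToHom_trans_assoc] at h ⊢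
      rw [reassoc_of% h, eqToHom_refl, Category.id_comp, eqToHom_trans_assoc]

theorem comulSymmetry_isReordering (X : AH k) : AddEnv.IsReordering ((comulSymmetry k).app X) :=
  powApp_isReordering _ _ ((reorder_isReordering k).conj _ _) X.word

instance : IsIso (comulSymmetry k) := by
  have : ∀ X, IsIso ((comulSymmetry k).app X) := fun X => (comulSymmetry_isReordering k X).isIso
  exact NatIso.isIso_of_isIso_app _

end Symmetry

end Heis

end

/-! ### The comultiplication and its colour symmetry -/

theorem theorem4 (k : Type u) [Field k] [CharZero k] :
    ∃ (Δ : AH k ⥤ AddEnv (AHAH k)) (hΔ : IsStrictMonoidal Δ), Δ.Additive ∧ Δ.Linear k ∧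
      (∃ (h₁ : Δ.obj (AH.up k) = blueRed k)
        (h₂ : Δ.obj (AH.up k ⊗ AH.up k) = blueRed k ⊗ blueRed k),
        Δ.map (AH.dot k) = eqToHom h₁ ≫ comulDot k ≫ eqToHom h₁.symm ∧
        Δ.map (AH.crossing k) = eqToHom h₂ ≫ comulCrossing k ≫ eqToHom h₂.symm ∧
        ∃ θ : Δ ⋙ AddEnv.map (AHAH.eta k) ≅ Δ,
          (∀ X, AddEnv.IsReordering (θ.hom.app X)) ∧
          IsMonoidalNatTrans
            (hΔ.comp (AddEnv.map_isStrictMonoidal (AHAH.eta k) (AHAH.eta_isStrictMonoidal k)))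
            hΔ θ.hom ∧
          θ.hom.app (AH.up k) = eqToHom (congrArg (AddEnv.map (AHAH.eta k)).obj h₁) ≫
            reorder k ≫ eqToHom h₁.symm) :=
  ⟨comul k, comul_isStrictMonoidal k, inferInstance, inferInstance, comul_up k, comul_up_up k,
    comul_dot k, comul_crossing k, asIso (comulSymmetry k), comulSymmetry_isReordering k,
    ⟨rfl, fun X Y => powApp_append _ _ _ X.word Y.word⟩, powApp_one _ _ _⟩
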